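/- Let $a,b>0$ with $a\neq b$, let $\mathcal{E}=\{(x,y)\in\mathbb{R}^2 : x^2/a^2+y^2/b^2=1\}$, and let $\mathcal{E}_c$ be an ellipse (possibly a circle) contained in the open interior of $\mathcal{E}$ such that at least one triangle is inscribed in $\mathcal{E}$ and has its three side lines tangent to $\mathcal{E}_c$. Let $\mathcal{T}$ be the (Poncelet) family of all triangles inscribed in $\mathcal{E}$ with the three side lines tangent to $\mathcal{E}_c$, and let $\mathcal{R}\subset\mathbb{R}^2$ be the region swept by the circumcircle over $\mathcal{T}$, that is, the union of the circumcircles of all triangles of $\mathcal{T}$. Let $f=(f_x,f_y)$ and $g=(g_x,g_y)$ be the foci of the image of $\mathcal{E}_c$ under the affine map $(x,y)\mapsto(x/a,y/b)$, which sends $\mathcal{E}$ to the unit circle (if that image is a circle, $f=g$ is its center). Then the topological boundary $\partial\mathcal{R}$ is exactly the set of real zeros $(x,y)$ of the following polynomial, which has degree exactly $4$ in $x,y$: \begin{align*} & -b^6 \left[ (-1 + f_y^2)g_x^2 + (-1 + f_y g_y)^2 + f_x^2 (-1 + g_x^2 + g_y^2) \right] x^2 \\ & + 2 a^5 b x \left[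 b \left( g_x (2 + f_y(f_y + g_y)) + f_x (2 + g_y(f_y + g_y)) \right) - \left( g_x (3 f_y + g_y) + f_x (f_y + 3 g_y) \right) y \right] \\ & + a^6 \Big[ b^2 \big( 1 - f_y^2 - g_x^2 + f_x^2(-1 + g_x^2) + (-1 + f_y^2) g_y^2 - 2 f_x g_x (2 + f_y g_y) \big) \\ & \qquad + 2b (f_x + g_x)(f_y g_x + f_x g_y) y - \big( (-1 + f_x g_x)^2 + (-1 + f_x^2) g_y^2 + f_y^2(-1 + g_x^2 + g_y^2) \big) y^2 \Big] \\ & - 4 a^3 b^2 x \Big[ b^2 (f_x + g_x + f_y g_x(f_y + g_y) + f_x g_y(f_y + g_y)) - b (g_x(3 f_y + g_y) + f_x(f_y + 3 g_y)) y + (f_x + g_x)(x^2 + y^2) \Big] \\ & + 2 a b^4 x \Big[ b^2(f_y + g_y)(f_y g_x + f_x g_y) - b (g_x(3 f_y + g_y) + f_x(f_y + 3 g_y)) y + 2(f_x + g_x)(x^2 + y^2) \Big] \\ & + a^4 b \Big[ 2 b^3 \big( 1 + g_x^2 - f_x^2(-1 + g_x^2) + 2 f_y g_y + g_y^2 + 2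 f_x (g_x + f_y g_x g_y) - f_y^2(-1 + g_y^2) \big) \\ & \qquad - b \big( 5 - 4 f_x g_x + (-1 + f_y^2) g_x^2 + f_y g_y(2 + f_y g_y) + f_x^2(-1 + g_x^2 + g_y^2) \big) x^2 - 4 b^2 (f_y + f_y g_x(f_x + g_x) + g_y + f_x(f_x + g_x) g_y) y \\ & \qquad + 2b \big( -1 - 2 f_y g_y - g_y^2 + f_y^2(-1 + g_x^2 + g_y^2) + f_x^2(g_x^2 + g_y^2) \big) y^2 + 4(f_y + g_y)y(x^2 + y^2) \Big] \\ & + a^2 b^2 \Big[ b^4 \big( 1 - g_x^2 + f_x^2(-1 + g_x^2) - 2 f_x f_y g_x g_y + (-1 + f_y^2) g_y^2 - f_y(f_y + 4 g_y) \big) \\ & \qquad + 2 b^3 \big( f_y(2 + g_x(f_x + g_x)) + (2 + f_x(f_x + g_x)) g_y \big) y - 4 b(f_y + g_y) y(x^2 + y^2) + 4(x^2 + y^2)^2 \\ & \qquad + b^2 \Big( 2 \big( -1 - 2 f_x g_x + (-1 + f_y^2) g_x^2 + f_y^2 g_y^2 + f_x^2(-1 + g_x^2 + g_y^2) \big) x^2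 \\ & \qquad\qquad - \big( 5 + f_x g_x(2 + f_x g_x) - 4 f_y g_y + (-1 + f_x^2) g_y^2 + f_y^2(-1 + g_x^2 + g_y^2) \big) y^2 \Big) \Big]. \end{align*} Moreover, $\partial\mathcal{R}$ is the union of two disjoint smooth regular simple closed curves. One of them is externally tangent to $\mathcal{E}$ at exactly two points: it is tangent to $\mathcal{E}$ at two distinct points, and all its other points lie strictly outside $\mathcal{E}$. The other is internally tangent to $\mathcal{E}$ at exactly two points: it is tangent to $\mathcal{E}$ at two distinct points, and all its other points lie strictly inside $\mathcal{E}$. -/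

import Mathlib

open scoped ContDiff

noncomputable section

namespace PonceletEnvelope

/-- The axis-aligned ellipse `(x / a)^2 + (y / b)^2 = 1` in the plane `ℂ ≃ ℝ²`. -/
def outerEllipse (a b : ℝ) : Set ℂ := {z | (z.re / a) ^ 2 + (z.im / b) ^ 2 = 1}

/-- The open region bounded by `outerEllipse a b`. -/
def outerInterior (a b : ℝ) : Set ℂ := {z | (z.re / a) ^ 2 + (z.im / b) ^ 2 < 1}

/-- The open region outside `outerEllipse a b`. -/
def outerExterior (a b : ℝ) : Set ℂ := {z | 1 < (z.re / a) ^ 2 + (z.im / b) ^ 2}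

/-- The affine map `(x, y) ↦ (a x, b y)`, which sends the unit circle to `outerEllipse a b`. -/
def scaling (a b : ℝ) (z : ℂ) : ℂ := ⟨a * z.re, b * z.im⟩

/-- The ellipse with foci `f`, `g` and major axis of length `2 * k`
(a nondegenerate ellipse exactly when `dist f g < 2 * k`; a circle if `f = g`). -/
def focalEllipse (f g : ℂ) (k : ℝ) : Set ℂ := {z | dist z f + dist z g = 2 * k}

/-- The inner ellipse (caustic) whose preimage under `scaling a b` is the ellipse with foci `f`, `g`
and major axis `2 * k`. Every ellipse of the plane is of this form, because `scaling a b` is an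
affine bijection (for `a, b > 0`). -/
def caustic (a b : ℝ) (f g : ℂ) (k : ℝ) : Set ℂ := scaling a b '' focalEllipse f g k

/-- A line is tangent to an ellipse iff it meets the ellipse in exactly one point. -/
def IsTangentLine (l : AffineSubspace ℝ ℂ) (K : Set ℂ) : Prop := ∃! p : ℂ, p ∈ l ∧ p ∈ K

/-- A (nondegenerate) triangle with its vertices on the ellipse `E` and its three side lines
tangent to the ellipse `K`. -/
structure IsPonceletTriangle (E K : Set ℂ) (T : Affine.Triangle ℝ ℂ) : Prop where
  inscribed : ∀ i, T.points i ∈ E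
  circumscribed : ∀ i j, i ≠ j → IsTangentLine (line[ℝ, T.points i, T.points j]) K

/-- The region swept by the circumcircle over the Poncelet triangles interscribed between
`E` and `K`: the union of all their circumcircles. -/
def sweptRegion (E K : Set ℂ) : Set ℂ :=
  {P | ∃ T : Affine.Triangle ℝ ℂ, IsPonceletTriangle E K T ∧ P ∈ T.circumsphere}

/-- A smooth regular simple closed curve, parametrized with period `2π`. -/
structure IsSmoothClosedCurve (γ : ℝ → ℂ) : Prop where
  smooth : ContDiff ℝ ∞ γ
  periodic : Function.Periodic γ (2 * Real.pi)
  regular : ∀ t, deriv γ t ≠ 0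
  simple : Set.InjOn γ (Set.Ico 0 (2 * Real.pi))

/-- The parametrized curve `γ` is tangent to the ellipse `E` at `P`: it passes through `P`, a point
of `E`, and its tangent line there is tangent to `E`. -/
def IsTangentAt (γ : ℝ → ℂ) (E : Set ℂ) (P : ℂ) : Prop :=
  P ∈ E ∧ ∃ t, γ t = P ∧ deriv γ t ≠ 0 ∧
    IsTangentLine (AffineSubspace.mk' P (Submodule.span ℝ {deriv γ t})) E

/-- The curve `γ` is tangent to `E` at exactly two points and at all its other points stays in the
set `S` (one of the two sides of `E`). -/
def IsTangentAtTwoPointsFrom (S : Set ℂ) (γ : ℝ → ℂ) (E : Set ℂ) : Prop :=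
  ∃ P Q : ℂ, P ≠ Q ∧ IsTangentAt γ E P ∧ IsTangentAt γ E Q ∧ Set.range γ \ {P, Q} ⊆ S

/-- The explicit expression whose zeros in `x, y` form the envelope. -/
def envelopeExpr {R : Type*} [CommRing R] (a b fx fy gx gy x y : R) : R :=
  -b ^ 6 * ((-1 + fy ^ 2) * gx ^ 2 + (-1 + fy * gy) ^ 2 + fx ^ 2 * (-1 + gx ^ 2 + gy ^ 2)) * x ^ 2
  + 2 * a ^ 5 * b * x *
      (b * (gx * (2 + fy * (fy + gy)) + fx * (2 + gy * (fy + gy)))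
        - (gx * (3 * fy + gy) + fx * (fy + 3 * gy)) * y)
  + a ^ 6 *
      (b ^ 2 * (1 - fy ^ 2 - gx ^ 2 + fx ^ 2 * (-1 + gx ^ 2) + (-1 + fy ^ 2) * gy ^ 2
          - 2 * fx * gx * (2 + fy * gy))
        + 2 * b * (fx + gx) * (fy * gx + fx * gy) * y
        - ((-1 + fx * gx) ^ 2 + (-1 + fx ^ 2) * gy ^ 2 + fy ^ 2 * (-1 + gx ^ 2 + gy ^ 2)) * y ^ 2)
  - 4 * a ^ 3 * b ^ 2 * x *
      (b ^ 2 * (fx + gx + fy * gx * (fy + gy) + fx * gy * (fy + gy))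
        - b * (gx * (3 * fy + gy) + fx * (fy + 3 * gy)) * y
        + (fx + gx) * (x ^ 2 + y ^ 2))
  + 2 * a * b ^ 4 * x *
      (b ^ 2 * (fy + gy) * (fy * gx + fx * gy)
        - b * (gx * (3 * fy + gy) + fx * (fy + 3 * gy)) * y
        + 2 * (fx + gx) * (x ^ 2 + y ^ 2))
  + a ^ 4 * b *
      (2 * b ^ 3 * (1 + gx ^ 2 - fx ^ 2 * (-1 + gx ^ 2) + 2 * fy * gy + gy ^ 2
          + 2 * fx * (gx + fy * gx * gy) - fy ^ 2 * (-1 + gy ^ 2))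
        - b * (5 - 4 * fx * gx + (-1 + fy ^ 2) * gx ^ 2 + fy * gy * (2 + fy * gy)
          + fx ^ 2 * (-1 + gx ^ 2 + gy ^ 2)) * x ^ 2
        - 4 * b ^ 2 * (fy + fy * gx * (fx + gx) + gy + fx * (fx + gx) * gy) * y
        + 2 * b * (-1 - 2 * fy * gy - gy ^ 2 + fy ^ 2 * (-1 + gx ^ 2 + gy ^ 2)
          + fx ^ 2 * (gx ^ 2 + gy ^ 2)) * y ^ 2
        + 4 * (fy + gy) * y * (x ^ 2 + y ^ 2))
  + a ^ 2 * b ^ 2 *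
      (b ^ 4 * (1 - gx ^ 2 + fx ^ 2 * (-1 + gx ^ 2) - 2 * fx * fy * gx * gy
          + (-1 + fy ^ 2) * gy ^ 2 - fy * (fy + 4 * gy))
        + 2 * b ^ 3 * (fy * (2 + gx * (fx + gx)) + (2 + fx * (fx + gx)) * gy) * y
        - 4 * b * (fy + gy) * y * (x ^ 2 + y ^ 2) + 4 * (x ^ 2 + y ^ 2) ^ 2
        + b ^ 2 *
          (2 * (-1 - 2 * fx * gx + (-1 + fy ^ 2) * gx ^ 2 + fy ^ 2 * gy ^ 2
              + fx ^ 2 * (-1 + gx ^ 2 + gy ^ 2)) * x ^ 2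
            - (5 + fx * gx * (2 + fx * gx) - 4 * fy * gy + (-1 + fx ^ 2) * gy ^ 2
              + fy ^ 2 * (-1 + gx ^ 2 + gy ^ 2)) * y ^ 2))

/-- The envelope polynomial in the two variables `X 0` (for `x`) and `X 1` (for `y`). -/
def envelopePoly (a b : ℝ) (f g : ℂ) : MvPolynomial (Fin 2) ℝ :=
  envelopeExpr (MvPolynomial.C a) (MvPolynomial.C b)
    (MvPolynomial.C f.re) (MvPolynomial.C f.im) (MvPolynomial.C g.re) (MvPolynomial.C g.im)
    (MvPolynomial.X 0) (MvPolynomial.X 1)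

end PonceletEnvelope

end

open scoped ComplexConjugate

noncomputable section

namespace PonceletEnvelope

/-! ### Tangent lines of an ellipse given by its foci -/

/-! Scaling turns the outer ellipse into the unit circle. There, tangency of a chord to an ellipse
with foci f, g is algebraic: the product of the signed distances from the foci to the chord equals
the squared semi-minor axis (`isTangentLine_focalEllipse_iff`). Three tangent chords force the
vertices to solve b(z) = l for the cubic Blaschke product b(z) = z(z - f)(z - g) / ((1 - f̄z)(1 -
ḡz)), with l the product of the vertices, and force the squared minor axis to be (1 - |f|²)(1 -
|g|²) (`minorAxis_sq_of_isChordTangent`). Conversely, every l on the unit circle has three such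
vertices (`exists_isVertex`) and they give a Poncelet triangle, so l parametrizes the family.

The symmetric functions of the vertices are affine in l. Consequently the power of the scaled point
w with respect to the circumcircle is, up to a positive factor, A(w) - ε Re(l̄ B(w)), with A =
`quadA` and B = `linB` (`exists_circle`). As l runs over the unit circle, w is swept exactly when
|A| ≤ |B|, and the envelope polynomial is a nonzero multiple of A² - |B|² (`envelopeExpr_eq`).

Since |fg| < 1, B is a real-affine bijection of the plane. In the coordinate u = B(w), A has
positive definite quadratic part and is negative at u = 0, so on each ray from 0 each of the
equations A = |u| and A = -|u| has exactly one positive solution. This yields two disjoint smooth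
polar curves, and moving along the ray across either of them leaves the region
(`frontier_abs_quadA_le`).

On |w| = 1 one has wB = (w - f)(w - g) and A = ε Re(wB), so |A| ≤ |B| there: the unit circle
separates the two curves and meets them only where (w - f)(w - g) is real. The argument of this
product winds twice, giving four points with alternating signs, two for each curve
(`exists_contact_points`). -/

theorem exists_real_on_segment {F H : ℂ} (h : F.im * H.im ≤ 0) :
    ∃ t : ℝ, dist F t + dist (t : ℂ) H = dist F H := by
  by_cases he : F.im = H.im
  · have h0 : F.im = 0 := by
      rw [← he] at h
      nlinarith [mul_self_nonneg F.im]
    refine ⟨F.re, ?_⟩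
    have : ((F.re : ℝ) : ℂ) = F := by
      apply Complex.ext <;> simp [h0]
    rw [this]; simp
  · have hd : F.im - H.im ≠ 0 := sub_ne_zero.2 he
    set r := F.im / (F.im - H.im) with hr
    have hd2 : 0 < (F.im - H.im) ^ 2 := by positivity
    have hr' : r = F.im * (F.im - H.im) / (F.im - H.im) ^ 2 := by
      rw [hr]; field_simp
    have hr0 : 0 ≤ r := by
      rw [hr']; apply div_nonneg _ hd2.le; nlinarith [mul_self_nonneg F.im]
    have hr1 : r ≤ 1 := by
      rw [hr', div_le_one hd2]; nlinarith [mul_self_nonneg H.im]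
    have hw : Wbtw ℝ F (AffineMap.lineMap F H r) H := ⟨r, ⟨hr0, hr1⟩, rfl⟩
    refine ⟨(AffineMap.lineMap F H r).re, ?_⟩
    have : (((AffineMap.lineMap F H r).re : ℝ) : ℂ) = AffineMap.lineMap F H r := by
      apply Complex.ext
      · simp
      · simp [AffineMap.lineMap_apply]
        rw [hr]; field_simp; ring
    rw [this]
    exact hw.dist_add_dist

theorem real_on_segment_unique {F H : ℂ} (h : F.im ≠ H.im) {s t : ℝ}
    (hs : dist F s + dist (s : ℂ) H = dist F H) (ht : dist F t + dist (t : ℂ) H = dist F H) :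
    s = t := by
  rw [dist_add_dist_eq_iff] at hs ht
  obtain ⟨r, -, hr⟩ := hs
  obtain ⟨r', -, hr'⟩ := ht
  have h1 := congrArg Complex.im hr
  have h2 := congrArg Complex.im hr'
  simp [AffineMap.lineMap_apply] at h1 h2
  have : r = r' := by
    have hd : H.im - F.im ≠ 0 := sub_ne_zero.2 h.symm
    apply mul_right_cancel₀ hd
    linarith
  rw [this, hr'] at hr
  exact_mod_cast hr.symm

theorem dist_conj_real (t : ℝ) (G : ℂ) : dist (t : ℂ) (conj G) = dist (t : ℂ) G := by
  have := Complex.dist_conj_conj (t : ℂ) G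
  rwa [Complex.conj_ofReal] at this

theorem dist_conj_sq (F G : ℂ) : dist F (conj G) ^ 2 = dist F G ^ 2 + 4 * (F.im * G.im) := by
  rw [Complex.dist_eq, Complex.dist_eq, ← Complex.normSq_eq_norm_sq, ← Complex.normSq_eq_norm_sq,
    Complex.normSq_apply, Complex.normSq_apply]
  simp
  ring

/-- The reflection principle: for foci on the same side of the real axis, the sum of distances has
minimum |F - Ḡ| on the axis, attained once, and tangency means that this minimum is κ. For foci on
opposite sides the minimum is |F - G| < κ, so the axis is a secant. -/
theorem existsUnique_real_dist_add_dist_iff {F G : ℂ} {κ : ℝ} (hκ : dist F G < κ) :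
    (∃! t : ℝ, dist (t : ℂ) F + dist (t : ℂ) G = κ) ↔ 4 * (F.im * G.im) = κ ^ 2 - dist F G ^ 2 := by
  have hκ0 : 0 < κ := lt_of_le_of_lt dist_nonneg hκ
  constructor
  · rintro ⟨t₀, ht₀, huniq⟩
    simp only at ht₀ huniq
    -- A value below κ would, by the intermediate value theorem, produce a solution on each side of
    -- it; at `F.re ± κ` the sum is already at least κ.
    have hge : ∀ t : ℝ, κ ≤ dist (t : ℂ) F + dist (t : ℂ) G := by
      by_contra! hcon
      obtain ⟨t₁, ht₁⟩ := hcon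
      have hcont : Continuous fun t : ℝ => dist (t : ℂ) F + dist (t : ℂ) G := by fun_prop
      have hlow : ∀ t : ℝ, |t - F.re| ≤ dist (t : ℂ) F + dist (t : ℂ) G := by
        intro t
        have h1 : |t - F.re| ≤ dist (t : ℂ) F := by
          have := Complex.abs_re_le_norm ((t : ℂ) - F)
          simpa [Complex.dist_eq] using this
        linarith [dist_nonneg (x := (t : ℂ)) (y := G)]
      have hb1 : F.re - κ ≤ t₁ := by
        have := (abs_le.1 ((hlow t₁).trans ht₁.le)).1
        linarith
      have hb2 : t₁ ≤ F.re + κ := by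
        have := (abs_le.1 ((hlow t₁).trans ht₁.le)).2
        linarith
      obtain ⟨r, hr, hr'⟩ := intermediate_value_Icc' hb1 hcont.continuousOn
        (show κ ∈ Set.Icc _ _ from ⟨ht₁.le, by
          have := hlow (F.re - κ)
          rw [show F.re - κ - F.re = -κ by ring, abs_neg, abs_of_pos hκ0] at this
          exact this⟩)
      obtain ⟨s, hs, hs'⟩ := intermediate_value_Icc hb2 hcont.continuousOn
        (show κ ∈ Set.Icc _ _ from ⟨ht₁.le, by
          have := hlow (F.re + κ)
          rw [show F.re + κ - F.re = κ by ring, abs_of_pos hκ0] at this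
          exact this⟩)
      have e1 := huniq r hr'
      have e2 := huniq s hs'
      have : r = t₁ := le_antisymm hr.2 (by rw [e1, ← e2]; exact hs.1)
      rw [this] at hr'
      simp only at hr'
      linarith
    have hpos : 0 < F.im * G.im := by
      by_contra! hcon
      obtain ⟨t, ht⟩ := exists_real_on_segment hcon
      have := hge t
      rw [dist_comm (t : ℂ) F, ht] at this
      linarith
    obtain ⟨t, ht⟩ := exists_real_on_segment (F := F) (H := conj G) (by simp; linarith)
    have h1 := hge t
    rw [dist_comm (t : ℂ) F, ← dist_conj_real, ht] at h1
    have h2 := dist_triangle F t₀ (conj G)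
    rw [dist_conj_real, dist_comm F (t₀ : ℂ), ht₀] at h2
    rw [le_antisymm h1 h2, dist_conj_sq]
    ring
  · intro h
    have hsq : κ ^ 2 = dist F (conj G) ^ 2 := by rw [dist_conj_sq]; linarith
    have hκe : κ = dist F (conj G) := by
      rwa [sq_eq_sq₀ hκ0.le dist_nonneg] at hsq
    have hpos : 0 < F.im * G.im := by
      nlinarith [dist_nonneg (x := F) (y := G)]
    obtain ⟨t, ht⟩ := exists_real_on_segment (F := F) (H := conj G) (by simp; linarith)
    refine ⟨t, ?_, ?_⟩
    · simp only
      rw [dist_comm (t : ℂ) F, ← dist_conj_real, ht, hκe]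
    · intro s hs
      rw [dist_comm (s : ℂ) F, ← dist_conj_real, hκe] at hs
      refine real_on_segment_unique ?_ hs ht
      intro he
      simp at he
      rw [he] at hpos
      nlinarith [mul_self_nonneg G.im]

theorem mem_line_iff {z₁ z₂ p : ℂ} :
    p ∈ line[ℝ, z₁, z₂] ↔ ∃ t : ℝ, p = z₁ + t * (z₂ - z₁) := by
  rw [mem_affineSpan_pair_iff_exists_lineMap_eq]
  simp only [AffineMap.lineMap_apply, vsub_eq_sub, vadd_eq_add, Complex.real_smul, add_comm,
    eq_comm (a := p)]

theorem isTangentLine_line_iff {z₁ z₂ : ℂ} (hz : z₁ ≠ z₂) (K : Set ℂ) :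
    IsTangentLine line[ℝ, z₁, z₂] K ↔ ∃! t : ℝ, z₁ + t * (z₂ - z₁) ∈ K := by
  have hd : z₂ - z₁ ≠ 0 := sub_ne_zero.2 hz.symm
  constructor
  · rintro ⟨p, ⟨hp, hpK⟩, hu⟩
    obtain ⟨t, rfl⟩ := mem_line_iff.1 hp
    refine ⟨t, hpK, fun s hs => ?_⟩
    have := hu _ ⟨mem_line_iff.2 ⟨s, rfl⟩, hs⟩
    have := mul_right_cancel₀ hd (add_left_cancel this)
    exact_mod_cast this
  · rintro ⟨t, ht, hu⟩
    refine ⟨_, ⟨mem_line_iff.2 ⟨t, rfl⟩, ht⟩, ?_⟩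
    rintro p ⟨hp, hpK⟩
    obtain ⟨s, rfl⟩ := mem_line_iff.1 hp
    rw [hu s hpK]

theorem conj_eq_inv_of_norm_one {z : ℂ} (hz : ‖z‖ = 1) : conj z = z⁻¹ :=
  (Complex.inv_eq_conj hz).symm

theorem isTangentLine_focalEllipse_iff {z₁ z₂ f g : ℂ} {k : ℝ} (h₁ : ‖z₁‖ = 1) (h₂ : ‖z₂‖ = 1)
    (hz : z₁ ≠ z₂) (hk : dist f g < 2 * k) :
    IsTangentLine line[ℝ, z₁, z₂] (focalEllipse f g k) ↔
      (f + z₁ * z₂ * conj f - (z₁ + z₂)) * (g + z₁ * z₂ * conj g - (z₁ + z₂)) =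
        ((4 * k ^ 2 - dist f g ^ 2 : ℝ) : ℂ) * (z₁ * z₂) := by
  rw [isTangentLine_line_iff hz]
  have hd : z₂ - z₁ ≠ 0 := sub_ne_zero.2 hz.symm
  set d := z₂ - z₁ with hddef
  have hdn : 0 < ‖d‖ := norm_pos_iff.2 hd
  have h10 : z₁ ≠ 0 := norm_ne_zero_iff.1 (by rw [h₁]; norm_num)
  have h20 : z₂ ≠ 0 := norm_ne_zero_iff.1 (by rw [h₂]; norm_num)
  -- The similarity w ↦ (w - z₁) / d carries the chord line to the real axis.
  have hdist : ∀ (t : ℝ) (h : ℂ), dist (z₁ + t * d) h = ‖d‖ * dist (t : ℂ) ((h - z₁) / d) := by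
    intro t h
    rw [Complex.dist_eq, Complex.dist_eq, ← norm_mul]
    congr 1
    field_simp
    ring
  have hFG : dist f g = ‖d‖ * dist ((f - z₁) / d) ((g - z₁) / d) := by
    rw [Complex.dist_eq, Complex.dist_eq, ← norm_mul]
    congr 1
    field_simp
    ring
  have hiff : (∃! t : ℝ, z₁ + t * d ∈ focalEllipse f g k) ↔
      ∃! t : ℝ, dist (t : ℂ) ((f - z₁) / d) + dist (t : ℂ) ((g - z₁) / d) = 2 * k / ‖d‖ := by
    apply existsUnique_congr
    intro t
    rw [focalEllipse, Set.mem_ofPred_eq, hdist, hdist, ← mul_add, eq_div_iff hdn.ne', mul_comm]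
  rw [hiff, existsUnique_real_dist_add_dist_iff (by rwa [lt_div_iff₀ hdn, mul_comm, ← hFG])]
  have hcd : conj d = -d / (z₁ * z₂) := by
    rw [hddef, map_sub, conj_eq_inv_of_norm_one h₁, conj_eq_inv_of_norm_one h₂]
    field_simp
    ring
  -- Up to the factor 2i·d, the left side is the signed distance from h to the chord in the
  -- normalized picture.
  have him : ∀ h : ℂ, h + z₁ * z₂ * conj h - (z₁ + z₂) = d * (2 * ((h - z₁) / d).im * Complex.I) := by
    intro h
    have e : (2 * ((h - z₁) / d).im * Complex.I : ℂ) = (h - z₁) / d - conj ((h - z₁) / d) := by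
      rw [Complex.sub_conj]; push_cast; ring
    rw [e, map_div₀, map_sub, hcd, conj_eq_inv_of_norm_one h₁]
    field_simp
    ring
  have hdd : d * d = -(z₁ * z₂) * ((‖d‖ ^ 2 : ℝ) : ℂ) := by
    rw [← Complex.normSq_eq_norm_sq, ← Complex.mul_conj, hcd]
    field_simp
  rw [him f, him g]
  set x := ((f - z₁) / d).im
  set y := ((g - z₁) / d).im
  have e : d * (2 * x * Complex.I) * (d * (2 * y * Complex.I)) =
      ((‖d‖ ^ 2 * (4 * (x * y)) : ℝ) : ℂ) * (z₁ * z₂) := by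
    rw [show d * (2 * x * Complex.I) * (d * (2 * y * Complex.I)) =
      (d * d) * (4 * x * y) * (Complex.I * Complex.I) by ring, hdd, Complex.I_mul_I]
    push_cast
    ring
  rw [e, mul_left_inj' (mul_ne_zero h10 h20), Complex.ofReal_inj, hFG]
  have e2 : 4 * k ^ 2 - (‖d‖ * dist ((f - z₁) / d) ((g - z₁) / d)) ^ 2 =
      ‖d‖ ^ 2 * ((2 * k / ‖d‖) ^ 2 - dist ((f - z₁) / d) ((g - z₁) / d) ^ 2) := by
    field_simp
    ring
  rw [e2, mul_right_inj' (by positivity)]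

/-! ### The Poncelet family in terms of the foci -/

theorem vieta_cubic {x y z s₁ s₂ s₃ : ℂ} (hxy : x ≠ y) (hxz : x ≠ z) (hyz : y ≠ z)
    (hx : x ^ 3 - s₁ * x ^ 2 + s₂ * x - s₃ = 0) (hy : y ^ 3 - s₁ * y ^ 2 + s₂ * y - s₃ = 0)
    (hz : z ^ 3 - s₁ * z ^ 2 + s₂ * z - s₃ = 0) :
    x + y + z = s₁ ∧ x * y + x * z + y * z = s₂ ∧ x * y * z = s₃ := by
  have h1 : x ^ 2 + x * y + y ^ 2 - s₁ * (x + y) + s₂ = 0 := by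
    apply mul_left_cancel₀ (sub_ne_zero.2 hxy)
    linear_combination hx - hy
  have h2 : x ^ 2 + x * z + z ^ 2 - s₁ * (x + z) + s₂ = 0 := by
    apply mul_left_cancel₀ (sub_ne_zero.2 hxz)
    linear_combination hx - hz
  have h3 : x + y + z = s₁ := by
    apply mul_left_cancel₀ (sub_ne_zero.2 hyz)
    linear_combination h1 - h2
  have h4 : x * y + x * z + y * z = s₂ := by
    linear_combination (x + y) * h3 - h1
  exact ⟨h3, h4, by linear_combination hx - x ^ 2 * h3 + x * h4⟩

theorem ne_zero_of_norm_one {z : ℂ} (hz : ‖z‖ = 1) : z ≠ 0 :=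
  norm_ne_zero_iff.1 (by rw [hz]; norm_num)

theorem one_sub_mul_ne_zero {f z : ℂ} (hf : ‖f‖ < 1) (hz : ‖z‖ = 1) : 1 - f * z ≠ 0 := by
  intro h
  have : f * z = 1 := (sub_eq_zero.1 h).symm
  have h2 := congrArg norm this
  rw [norm_mul, hz, norm_one] at h2
  linarith

/-- The vertices on the unit circle of the triangles about an ellipse with foci `f`, `g` are the
solutions `z` of this equation, with the product `l` of the three vertices as parameter. -/
def IsVertex (f g l z : ℂ) : Prop :=
  z * (z - f) * (z - g) = l * (1 - conj f * z) * (1 - conj g * z)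

theorem IsVertex.symmetric_functions {f g l x y z : ℂ} (hxy : x ≠ y) (hxz : x ≠ z) (hyz : y ≠ z)
    (hx : IsVertex f g l x) (hy : IsVertex f g l y) (hz : IsVertex f g l z) :
    x + y + z = f + g + l * (conj f * conj g) ∧
      x * y + x * z + y * z = f * g + l * (conj f + conj g) ∧ x * y * z = l := by
  unfold IsVertex at hx hy hz
  apply vieta_cubic hxy hxz hyz
  · linear_combination hx
  · linear_combination hy
  · linear_combination hz

/-- The condition for the chord `x y` of the unit circle to be tangent to an ellipse with foci
`f`, `g` and squared minor axis `m`. -/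
def IsChordTangent (f g m x y : ℂ) : Prop :=
  (f + x * y * conj f - (x + y)) * (g + x * y * conj g - (x + y)) = m * (x * y)

theorem IsChordTangent.symm {f g m x y : ℂ} (h : IsChordTangent f g m x y) :
    IsChordTangent f g m y x := by
  unfold IsChordTangent at *
  linear_combination h

/-- For fixed x, the tangency condition is quadratic in the other endpoint, with roots y and z.
Subtracting the two conditions and cancelling y - z gives the sum of the roots. -/
theorem IsChordTangent.isVertex {f g m x y z : ℂ} (hyz : y ≠ z)
    (hxy : IsChordTangent f g m x y) (hxz : IsChordTangent f g m x z) :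
    IsVertex f g (x * y * z) x ∧
      (1 - x * conj f) * (1 - x * conj g) * (y + z) =
        (f - x) * (1 - x * conj g) + (g - x) * (1 - x * conj f) + m * x := by
  unfold IsChordTangent at hxy hxz
  have h1 : (1 - x * conj f) * (1 - x * conj g) * (y + z) =
        (f - x) * (1 - x * conj g) + (g - x) * (1 - x * conj f) + m * x := by
    apply mul_left_cancel₀ (sub_ne_zero.2 hyz)
    linear_combination hxy - hxz
  refine ⟨?_, h1⟩
  unfold IsVertex
  linear_combination (-x * y) * h1 + x * hxy

/-- The sum y + z is known twice: from the quadratic of tangents through x, which involves m, and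
from Vieta for the vertex cubic, which does not. Comparison determines m. -/
theorem minorAxis_sq_of_isChordTangent {f g m x y z : ℂ} (hx0 : x ≠ 0) (hne : x ≠ y) (hxz' : x ≠ z) (hyz' : y ≠ z)
    (hxy : IsChordTangent f g m x y) (hxz : IsChordTangent f g m x z)
    (hyz : IsChordTangent f g m y z) :
    m = (1 - f * conj f) * (1 - g * conj g) ∧ IsVertex f g (x * y * z) x ∧
      IsVertex f g (x * y * z) y ∧ IsVertex f g (x * y * z) z := by
  obtain ⟨vx, sx⟩ := hxy.isVertex hyz' hxz
  have vy := (hxy.symm.isVertex hxz' hyz).1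
  have vz := (hxz.symm.isVertex hne hyz.symm).1
  rw [mul_comm y x] at vy
  rw [show z * x * y = x * y * z by ring] at vz
  refine ⟨?_, vx, vy, vz⟩
  obtain ⟨h1, -, -⟩ := IsVertex.symmetric_functions hne hxz' hyz' vx vy vz
  have h2 : y + z = f + g + x * y * z * (conj f * conj g) - x := by linear_combination h1
  rw [h2] at sx
  apply mul_right_cancel₀ hx0
  unfold IsVertex at vx
  linear_combination -sx - (conj f * conj g) * vx

theorem IsVertex.isChordTangent {f g l x y z : ℂ} (hf : ‖f‖ < 1) (hg : ‖g‖ < 1)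
    (hz : ‖z‖ = 1) (hxy : x ≠ y) (hxz : x ≠ z) (hyz : y ≠ z)
    (vx : IsVertex f g l x) (vy : IsVertex f g l y) (vz : IsVertex f g l z) :
    IsChordTangent f g ((1 - f * conj f) * (1 - g * conj g)) x y := by
  obtain ⟨h1, h2, h3⟩ := IsVertex.symmetric_functions hxy hxz hyz vx vy vz
  have hz0 := ne_zero_of_norm_one hz
  have hff := one_sub_mul_ne_zero (f := conj f) (by simpa using hf) hz
  have hgg := one_sub_mul_ne_zero (f := conj g) (by simpa using hg) hz
  unfold IsVertex at vz
  -- Vieta expresses x + y and xy through z and l, and the vertex equation of z then eliminates l.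
  have e1 : (f + x * y * conj f - (x + y)) * (1 - conj f * z) = (z - g) * (1 - f * conj f) := by
    apply mul_left_cancel₀ (mul_ne_zero hz0 hgg)
    linear_combination (-z * (1 - conj f * z) * (1 - conj g * z)) * h1 +
      conj f * (1 - conj f * z) * (1 - conj g * z) * h3 - conj f * (1 - conj g * z) * vz
  have e2 : (g + x * y * conj g - (x + y)) * (1 - conj g * z) = (z - f) * (1 - g * conj g) := by
    apply mul_left_cancel₀ (mul_ne_zero hz0 hff)
    linear_combination (-z * (1 - conj f * z) * (1 - conj g * z)) * h1 +
      conj g * (1 - conj f * z) * (1 - conj g * z) * h3 - conj g * (1 - conj f * z) * vz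
  unfold IsChordTangent
  apply mul_left_cancel₀ (mul_ne_zero (mul_ne_zero hz0 hff) hgg)
  linear_combination z * (f + x * y * conj f - (x + y)) * (1 - conj f * z) * e2 +
    z * ((z - f) * (1 - g * conj g)) * e1 + (1 - f * conj f) * (1 - g * conj g) * vz -
    (1 - f * conj f) * (1 - g * conj g) * (1 - conj f * z) * (1 - conj g * z) * h3

/-! ### Solving equations on the unit circle by their phase -/

theorem surjective_of_bounded_sub_linear {ψ : ℝ → ℝ} (hc : Continuous ψ) {n M : ℝ} (hn : 0 < n)
    (hb : ∀ θ, |ψ θ - n * θ| ≤ M) : Function.Surjective ψ := by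
  intro c
  have h1 := (abs_le.1 (hb ((c - M) / n))).2
  have h2 := (abs_le.1 (hb ((c + M) / n))).1
  rw [mul_div_cancel₀ _ hn.ne'] at h1 h2
  exact mem_range_of_exists_le_of_exists_ge hc ⟨(c - M) / n, by linarith⟩
    ⟨(c + M) / n, by linarith⟩

/-- ψ lifts a circle map of degree n. Two angles of the same point differ by 2πm, so their ψ-values
differ by 2πnm, whereas the prescribed values differ by less than 2πn. -/
theorem exp_injective_of_phase {ψ : ℝ → ℝ} {n : ℕ}
    (hper : ∀ (θ : ℝ) (m : ℤ), ψ (θ + m * (2 * Real.pi)) = ψ θ + n * (m * (2 * Real.pi)))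
    {θ : Fin n → ℝ} {c : ℝ} (hθ : ∀ j, ψ (θ j) = c + 2 * Real.pi * (j : ℕ)) :
    Function.Injective fun j => Complex.exp (θ j * Complex.I) := by
  intro i j hij
  obtain ⟨m, hm⟩ := Complex.exp_eq_exp_iff_exists_int.1 hij
  have h1 : θ i = θ j + m * (2 * Real.pi) := by
    have : ((θ i : ℝ) : ℂ) = ((θ j + m * (2 * Real.pi) : ℝ) : ℂ) := by
      apply mul_right_cancel₀ Complex.I_ne_zero
      rw [hm]; push_cast; ring
    exact_mod_cast this
  have h2 := hper (θ j) m
  rw [← h1, hθ, hθ] at h2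
  have h3 : ((i : ℕ) : ℝ) = (j : ℕ) + n * m := by
    have hpi : (2 * Real.pi) ≠ 0 := by positivity
    apply mul_left_cancel₀ hpi
    linarith
  have h4 : ((i : ℕ) : ℤ) = (j : ℕ) + n * m := by exact_mod_cast h3
  have hi := i.2
  have hj := j.2
  apply Fin.ext
  have h5 : m = 0 := by
    by_contra hm0
    rcases lt_or_gt_of_ne hm0 with h | h
    · have : (n : ℤ) * m ≤ -n := by nlinarith
      omega
    · have : (n : ℤ) ≤ n * m := by nlinarith
      omega
  rw [h5] at h4
  omega

/-- A continuous choice of the argument of `(z - f) * (z - g)` at `z = exp (θ * I)`. -/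
def phase (f g : ℂ) (θ : ℝ) : ℝ :=
  2 * θ + Complex.arg (1 - f * Complex.exp (-(θ * Complex.I))) +
    Complex.arg (1 - g * Complex.exp (-(θ * Complex.I)))

/-- Keeps the argument off the branch cut, so that `phase` is continuous. -/
theorem re_one_sub_mul_exp_pos {f : ℂ} (hf : ‖f‖ < 1) (θ : ℝ) :
    0 < (1 - f * Complex.exp (-(θ * Complex.I))).re := by
  have h := Complex.re_le_norm (f * Complex.exp (-(θ * Complex.I)))
  have h2 : ‖Complex.exp (-(θ * Complex.I))‖ = 1 := by
    have := Complex.norm_exp_ofReal_mul_I (-θ)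
    push_cast at this
    rwa [neg_mul] at this
  rw [norm_mul, h2, mul_one] at h
  rw [Complex.sub_re, Complex.one_re]
  linarith

theorem continuous_arg_one_sub {f : ℂ} (hf : ‖f‖ < 1) :
    Continuous fun θ : ℝ => Complex.arg (1 - f * Complex.exp (-(θ * Complex.I))) := by
  rw [continuous_iff_continuousAt]
  intro θ
  have h : ContinuousAt (fun θ : ℝ => 1 - f * Complex.exp (-(θ * Complex.I))) θ := by fun_prop
  exact ContinuousAt.comp (f := fun θ : ℝ => 1 - f * Complex.exp (-(θ * Complex.I)))
    (Complex.continuousAt_arg (Or.inl (re_one_sub_mul_exp_pos hf θ))) h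

theorem continuous_phase {f g : ℂ} (hf : ‖f‖ < 1) (hg : ‖g‖ < 1) : Continuous (phase f g) :=
  ((continuous_const.mul continuous_id).add (continuous_arg_one_sub hf)).add
    (continuous_arg_one_sub hg)

theorem abs_phase_sub_le (f g : ℂ) (θ : ℝ) : |phase f g θ - 2 * θ| ≤ 2 * Real.pi := by
  have h1 := Complex.abs_arg_le_pi (1 - f * Complex.exp (-(θ * Complex.I)))
  have h2 := Complex.abs_arg_le_pi (1 - g * Complex.exp (-(θ * Complex.I)))
  rw [phase, add_assoc, add_sub_cancel_left]
  exact (abs_add_le _ _).trans (by linarith)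

theorem phase_add (f g : ℂ) (θ : ℝ) (m : ℤ) :
    phase f g (θ + m * (2 * Real.pi)) = phase f g θ + 2 * (m * (2 * Real.pi)) := by
  have : Complex.exp (-(((θ + m * (2 * Real.pi) : ℝ) : ℂ) * Complex.I)) =
      Complex.exp (-(θ * Complex.I)) := by
    rw [Complex.exp_eq_exp_iff_exists_int]
    exact ⟨-m, by push_cast; ring⟩
  rw [phase, phase, this]
  ring

theorem mul_sub_eq_norm_mul_exp_phase {f g : ℂ} (θ : ℝ) :
    (Complex.exp (θ * Complex.I) - f) * (Complex.exp (θ * Complex.I) - g) =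
      ‖(Complex.exp (θ * Complex.I) - f) * (Complex.exp (θ * Complex.I) - g)‖ *
        Complex.exp (phase f g θ * Complex.I) := by
  have key : ∀ h : ℂ, Complex.exp (θ * Complex.I) - h = ‖Complex.exp (θ * Complex.I) - h‖ *
      Complex.exp ((θ + Complex.arg (1 - h * Complex.exp (-(θ * Complex.I))) : ℝ) * Complex.I) := by
    intro h
    set u := 1 - h * Complex.exp (-(θ * Complex.I)) with hu
    have e1 : Complex.exp (θ * Complex.I) - h = Complex.exp (θ * Complex.I) * u := by
      have : Complex.exp (θ * Complex.I) * Complex.exp (-(θ * Complex.I)) = 1 := by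
        rw [← Complex.exp_add]; simp
      rw [hu]
      linear_combination h * this
    rw [e1, norm_mul, Complex.norm_exp_ofReal_mul_I, one_mul]
    conv_lhs => rw [← Complex.norm_mul_exp_arg_mul_I u]
    push_cast
    rw [add_mul, Complex.exp_add]
    ring
  conv_lhs => rw [key f, key g]
  rw [norm_mul, phase]
  push_cast
  rw [mul_mul_mul_comm, ← Complex.exp_add]
  congr 2
  ring

theorem sub_ne_zero_of_norm {f z : ℂ} (hf : ‖f‖ < 1) (hz : ‖z‖ = 1) : z - f ≠ 0 := by
  intro h
  rw [sub_eq_zero.1 h] at hz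
  linarith

/-- For each `l` on the unit circle there are three vertices on the unit circle. -/
theorem exists_isVertex {f g l : ℂ} (hf : ‖f‖ < 1) (hg : ‖g‖ < 1) (hl : ‖l‖ = 1) :
    ∃ x y z : ℂ, ‖x‖ = 1 ∧ ‖y‖ = 1 ∧ ‖z‖ = 1 ∧ x ≠ y ∧ x ≠ z ∧ y ≠ z ∧
      IsVertex f g l x ∧ IsVertex f g l y ∧ IsVertex f g l z := by
  -- With G = (z - f)(z - g), the Blaschke product on the unit circle equals G / (z Ḡ), whose
  -- argument is ψ. It grows by 3·2π per turn, hence three solutions.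
  set ψ : ℝ → ℝ := fun θ => 2 * phase f g θ - θ with hψ
  have hsurj : Function.Surjective ψ := by
    refine surjective_of_bounded_sub_linear (n := 3) (M := 4 * Real.pi) ?_ (by norm_num) ?_
    · exact (continuous_const.mul (continuous_phase hf hg)).sub continuous_id
    · intro θ
      have := abs_phase_sub_le f g θ
      rw [hψ, show (fun θ => 2 * phase f g θ - θ) θ - 3 * θ = 2 * (phase f g θ - 2 * θ) by
        simp only; ring, abs_mul, abs_two]
      linarith
  choose θ hθ using fun j : Fin 3 => hsurj (Complex.arg l + 2 * Real.pi * (j : ℕ))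
  have hinj := exp_injective_of_phase (ψ := ψ) (n := 3) (by
    intro θ m
    simp only [hψ, phase_add]
    push_cast
    ring) hθ
  have hv : ∀ j, IsVertex f g l (Complex.exp (θ j * Complex.I)) := by
    intro j
    have h1 := mul_sub_eq_norm_mul_exp_phase (f := f) (g := g) (θ j)
    have hn := Complex.norm_exp_ofReal_mul_I (θ j)
    have hexp : Complex.exp (phase f g (θ j) * Complex.I) ^ 2 =
        l * Complex.exp (θ j * Complex.I) := by
      have e := Complex.norm_mul_exp_arg_mul_I l
      rw [hl, Complex.ofReal_one, one_mul] at e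
      rw [← Complex.exp_nat_mul, ← e, ← Complex.exp_add, Complex.exp_eq_exp_iff_exists_int]
      refine ⟨(j : ℕ), ?_⟩
      have h2 : 2 * (phase f g (θ j) : ℂ) - θ j = Complex.arg l + 2 * Real.pi * (j : ℕ) := by
        exact_mod_cast hθ j
      push_cast
      linear_combination Complex.I * h2
    set z := Complex.exp (θ j * Complex.I)
    set G := (z - f) * (z - g) with hG
    have hG0 : G ≠ 0 := mul_ne_zero (sub_ne_zero_of_norm hf hn) (sub_ne_zero_of_norm hg hn)
    have h3 : G = l * z * conj G := by
      apply mul_left_cancel₀ hG0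
      have h4 : G * conj G = (‖G‖ : ℂ) ^ 2 := by
        rw [Complex.mul_conj, Complex.normSq_eq_norm_sq]; push_cast; ring
      rw [show G * (l * z * conj G) = l * z * (G * conj G) by ring, h4]
      rw [← hexp]
      conv_lhs => rw [h1]
      ring
    have hz0 := ne_zero_of_norm_one hn
    have hc : conj G = (z⁻¹ - conj f) * (z⁻¹ - conj g) := by
      rw [hG, map_mul, map_sub, map_sub, conj_eq_inv_of_norm_one hn]
    unfold IsVertex
    rw [mul_assoc, ← hG, h3, hc]
    field_simp
  exact ⟨_, _, _, Complex.norm_exp_ofReal_mul_I (θ 0), Complex.norm_exp_ofReal_mul_I (θ 1),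
    Complex.norm_exp_ofReal_mul_I (θ 2), fun h => absurd (hinj h) (by decide),
    fun h => absurd (hinj h) (by decide), fun h => absurd (hinj h) (by decide), hv 0, hv 1, hv 2⟩

/-! ### The affine normalization -/

theorem scaling_re (a b : ℝ) (w : ℂ) : (scaling a b w).re = a * w.re := rfl

theorem scaling_im (a b : ℝ) (w : ℂ) : (scaling a b w).im = b * w.im := rfl

theorem scaling_injective {a b : ℝ} (ha : 0 < a) (hb : 0 < b) :
    Function.Injective (scaling a b) := by
  intro z w h
  have h1 := congrArg Complex.re h
  have h2 := congrArg Complex.im h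
  rw [scaling_re, scaling_re, mul_right_inj' ha.ne'] at h1
  rw [scaling_im, scaling_im, mul_right_inj' hb.ne'] at h2
  exact Complex.ext h1 h2

theorem scaling_surjective {a b : ℝ} (ha : 0 < a) (hb : 0 < b) :
    Function.Surjective (scaling a b) := by
  intro z
  refine ⟨⟨z.re / a, z.im / b⟩, Complex.ext ?_ ?_⟩
  · rw [scaling_re]; field_simp
  · rw [scaling_im]; field_simp

theorem scaled_sq_add_sq {a b : ℝ} (ha : 0 < a) (hb : 0 < b) (w : ℂ) :
    ((scaling a b w).re / a) ^ 2 + ((scaling a b w).im / b) ^ 2 = Complex.normSq w := by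
  rw [scaling_re, scaling_im, mul_div_cancel_left₀ _ ha.ne', mul_div_cancel_left₀ _ hb.ne',
    Complex.normSq_apply]
  ring

theorem scaling_mem_outerEllipse {a b : ℝ} (ha : 0 < a) (hb : 0 < b) {w : ℂ} :
    scaling a b w ∈ outerEllipse a b ↔ ‖w‖ = 1 := by
  change _ = _ ↔ _
  rw [scaled_sq_add_sq ha hb, Complex.normSq_eq_norm_sq, pow_eq_one_iff_of_nonneg (norm_nonneg w) two_ne_zero]

theorem scaling_mem_outerInterior {a b : ℝ} (ha : 0 < a) (hb : 0 < b) {w : ℂ} :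
    scaling a b w ∈ outerInterior a b ↔ ‖w‖ < 1 := by
  change (_ : ℝ) < _ ↔ _
  rw [scaled_sq_add_sq ha hb, Complex.normSq_eq_norm_sq, sq_lt_one_iff₀ (norm_nonneg w)]

theorem scaling_mem_outerExterior {a b : ℝ} (ha : 0 < a) (hb : 0 < b) {w : ℂ} :
    scaling a b w ∈ outerExterior a b ↔ 1 < ‖w‖ := by
  change (_ : ℝ) < _ ↔ _
  rw [scaled_sq_add_sq ha hb, Complex.normSq_eq_norm_sq, one_lt_sq_iff₀ (norm_nonneg w)]

theorem scaling_add_mul (a b : ℝ) (z v : ℂ) (t : ℝ) :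
    scaling a b (z + t * v) = scaling a b z + t * scaling a b v := by
  apply Complex.ext <;> simp [scaling_re, scaling_im] <;> ring

theorem scaling_sub (a b : ℝ) (z v : ℂ) :
    scaling a b (z - v) = scaling a b z - scaling a b v := by
  apply Complex.ext <;> simp [scaling_re, scaling_im] <;> ring

theorem isTangentLine_scaling_iff {a b : ℝ} (ha : 0 < a) (hb : 0 < b) {x y : ℂ} (hxy : x ≠ y)
    (K : Set ℂ) : IsTangentLine line[ℝ, scaling a b x, scaling a b y] (scaling a b '' K) ↔
      IsTangentLine line[ℝ, x, y] K := by
  rw [isTangentLine_line_iff hxy,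
    isTangentLine_line_iff fun h => hxy (scaling_injective ha hb h)]
  apply existsUnique_congr
  intro t
  rw [← scaling_sub, ← scaling_add_mul, (scaling_injective ha hb).mem_set_image]

theorem focalEllipse_comm (f g : ℂ) (k : ℝ) : focalEllipse f g k = focalEllipse g f k := by
  ext z
  change _ = _ ↔ _ = _
  rw [add_comm]

/-- A focus is a convex combination of the endpoints of the major axis, which lie on the ellipse and
hence in the disc. -/
theorem norm_focus_lt_one {f g : ℂ} {k : ℝ} (hk : dist f g < 2 * k)
    (h : ∀ w ∈ focalEllipse f g k, ‖w‖ < 1) : ‖f‖ < 1 := by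
  obtain ⟨u, hu, hfg⟩ : ∃ u : ℂ, ‖u‖ = 1 ∧ f - g = (dist f g : ℝ) * u := by
    by_cases h0 : f = g
    -- For a circle any diameter serves as major axis.
    · exact ⟨1, by simp, by simp [h0]⟩
    · have hn : (‖f - g‖ : ℂ) ≠ 0 := by
        rw [Complex.ofReal_ne_zero, norm_ne_zero_iff]
        exact sub_ne_zero.2 h0
      refine ⟨(f - g) / (‖f - g‖ : ℂ), ?_, ?_⟩
      · rw [norm_div, Complex.norm_real, norm_norm, div_self]
        exact_mod_cast hn
      · rw [Complex.dist_eq]; field_simp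
  set D := dist f g with hD
  have hD0 : 0 ≤ D := dist_nonneg
  have hmem : ∀ s : ℝ, |s| = k → (f + g) / 2 + s * u ∈ focalEllipse f g k := by
    intro s hs
    have e1 : (f + g) / 2 + s * u - f = ((s - D / 2 : ℝ) : ℂ) * u := by
      push_cast; linear_combination (-1 / 2 : ℂ) * hfg
    have e2 : (f + g) / 2 + s * u - g = ((s + D / 2 : ℝ) : ℂ) * u := by
      push_cast; linear_combination (1 / 2 : ℂ) * hfg
    change _ + _ = _
    rw [Complex.dist_eq, Complex.dist_eq, e1, e2, norm_mul, norm_mul, hu, Complex.norm_real,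
      Complex.norm_real, Real.norm_eq_abs, Real.norm_eq_abs]
    rcases abs_cases s with ⟨h1, h2⟩ | ⟨h1, h2⟩
    · rw [abs_of_pos (by linarith), abs_of_pos (by linarith)]; linarith
    · rw [abs_of_neg (by linarith), abs_of_neg (by linarith)]; linarith
  have hk0 : 0 < k := by linarith
  have hp := h _ (hmem k (abs_of_pos hk0))
  have hm := h _ (hmem (-k) (by rw [abs_neg, abs_of_pos hk0]))
  have hc := (convex_ball (0 : ℂ) 1) (mem_ball_zero_iff.2 hp) (mem_ball_zero_iff.2 hm)
    (a := (1 + D / (2 * k)) / 2) (b := (1 - D / (2 * k)) / 2) (by positivity)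
    (by
      have : D / (2 * k) ≤ 1 := by rw [div_le_one (by linarith)]; exact hk.le
      linarith) (by ring)
  rw [mem_ball_zero_iff] at hc
  have hfe : ((1 + D / (2 * k)) / 2) • ((f + g) / 2 + k * u) +
      ((1 - D / (2 * k)) / 2) • ((f + g) / 2 + (-k : ℝ) * u) = f := by
    rw [Complex.real_smul, Complex.real_smul]
    push_cast
    have : (k : ℂ) ≠ 0 := by exact_mod_cast hk0.ne'
    field_simp
    linear_combination (-4 : ℂ) * k * hfg
  rwa [hfe] at hc

/-! ### The circumcircles -/

/-- With `linB`, the power of a point of the plane with respect to the circumcircles. -/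
def quadA (K ε : ℝ) (f g w : ℂ) : ℝ :=
  K * (Complex.normSq w - 1) + ε * ((w - f) * (w - g)).re

/-- With `quadA`, the power of a point of the plane with respect to the circumcircles. -/
def linB (f g w : ℂ) : ℂ := w + f * g * conj w - (f + g)

theorem exists_circle {a b d ε : ℝ} (ha : 0 < a) (hb : 0 < b) (hd : 0 < d)
    (hεd : ε * d = a ^ 2 - b ^ 2) (f g l : ℂ) :
    ∃ (C : ℂ) (r : ℝ), ∀ w, dist (scaling a b w) C ^ 2 - r =
      d / 2 * (quadA ((a ^ 2 + b ^ 2) / d) ε f g w - ε * (conj l * linB f g w).re) := by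
  -- Four concyclic points of the ellipse have eccentric angles of sum 0 modulo 2π, so for |l| = 1
  -- the fourth intersection of the circumcircle with the ellipse has parameter l̄. Thus `e` is the
  -- sum of the four parameters; the bracket multiplied by (a² - b²)/4 in the radius term is their
  -- second symmetric function.
  set e : ℂ := f + g + l * conj f * conj g + conj l
  set c : ℝ := (a ^ 2 - b ^ 2) / 4
  refine ⟨⟨c * e.re / a, -(c * e.im) / b⟩, (c * e.re / a) ^ 2 + (-(c * e.im) / b) ^ 2 -
    (c * (2 * (f * g).re + 2 * (conj l * (f + g)).re) - (a ^ 2 + b ^ 2) / 2), fun w => ?_⟩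
  have hε : ε = (a ^ 2 - b ^ 2) / d := by field_simp; exact hεd
  rw [Complex.dist_eq, ← Complex.normSq_eq_norm_sq, Complex.normSq_apply, Complex.sub_re,
    Complex.sub_im, scaling_re, scaling_im, quadA, linB, hε, Complex.normSq_apply]
  simp only [c, e, Complex.add_re, Complex.mul_re, Complex.conj_re, Complex.conj_im,
    Complex.add_im, Complex.mul_im, Complex.sub_re, Complex.sub_im]
  field_simp
  ring

theorem normSq_eq_one {w : ℂ} (hw : ‖w‖ = 1) : Complex.normSq w = 1 := by
  rw [Complex.normSq_eq_norm_sq, hw, one_pow]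

theorem mul_linB_of_norm_one {f g w : ℂ} (hw : ‖w‖ = 1) :
    w * linB f g w = (w - f) * (w - g) := by
  have : w * conj w = 1 := by rw [Complex.mul_conj, normSq_eq_one hw, Complex.ofReal_one]
  unfold linB
  linear_combination f * g * this

theorem quadA_of_norm_one {K ε : ℝ} {f g w : ℂ} (hw : ‖w‖ = 1) :
    quadA K ε f g w = ε * ((w - f) * (w - g)).re := by
  rw [quadA, normSq_eq_one hw]; ring

theorem IsVertex.quadA_eq {K ε : ℝ} {f g l z : ℂ} (hz : ‖z‖ = 1)
    (h : IsVertex f g l z) :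
    quadA K ε f g z = ε * (conj l * linB f g z).re := by
  rw [quadA_of_norm_one hz, ← Complex.conj_re (conj l * linB f g z)]
  congr 2
  have hz0 := ne_zero_of_norm_one hz
  rw [map_mul, Complex.conj_conj, linB]
  simp only [map_sub, map_add, map_mul, Complex.conj_conj]
  rw [conj_eq_inv_of_norm_one hz]
  unfold IsVertex at h
  apply mul_left_cancel₀ hz0
  rw [← mul_assoc, h]
  field_simp
  ring

theorem mem_circumsphere_iff {T : Affine.Triangle ℝ ℂ} {C : ℂ} {r : ℝ}
    (h : ∀ i, dist (T.points i) C ^ 2 = r) (P : ℂ) :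
    P ∈ T.circumsphere ↔ dist P C ^ 2 = r := by
  have htop : affineSpan ℝ (Set.range T.points) = ⊤ := by
    rw [T.independent.affineSpan_eq_top_iff_card_eq_finrank_add_one]
    simp [Complex.finrank_real_complex]
  have hr : 0 ≤ r := (h 0) ▸ sq_nonneg _
  have hd : ∀ i, dist (T.points i) C = √r := fun i => by
    rw [← h i, Real.sqrt_sq dist_nonneg]
  have hC : C ∈ affineSpan ℝ (Set.range T.points) := htop ▸ AffineSubspace.mem_top ℝ ℂ C
  have h1 := T.eq_circumcenter_of_dist_eq hC hd
  have h2 := T.eq_circumradius_of_dist_eq hC hd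
  rw [EuclideanGeometry.mem_sphere, T.circumsphere_center, T.circumsphere_radius, ← h1, ← h2,
    eq_comm, Real.sqrt_eq_iff_eq_sq hr dist_nonneg, eq_comm]

theorem mem_circumsphere_iff_of_isVertex {a b d ε : ℝ} (ha : 0 < a) (hb : 0 < b) (hd : 0 < d)
    (hεd : ε * d = a ^ 2 - b ^ 2) {f g l : ℂ} {T : Affine.Triangle ℝ ℂ}
    {z : Fin 3 → ℂ} (hz : ∀ i, ‖z i‖ = 1) (hv : ∀ i, IsVertex f g l (z i))
    (hT : ∀ i, T.points i = scaling a b (z i)) (w : ℂ) :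
    scaling a b w ∈ T.circumsphere ↔
      quadA ((a ^ 2 + b ^ 2) / d) ε f g w = ε * (conj l * linB f g w).re := by
  obtain ⟨C, r, hC⟩ := exists_circle ha hb hd hεd f g l
  have h1 : ∀ i, dist (T.points i) C ^ 2 = r := by
    intro i
    rw [hT, ← sub_eq_zero, hC, (hv i).quadA_eq (hz i), sub_self, mul_zero]
  rw [mem_circumsphere_iff h1, ← sub_eq_zero, hC, mul_eq_zero, or_iff_right (by positivity),
    sub_eq_zero]

theorem IsPonceletTriangle.exists_vertices {a b : ℝ} (ha : 0 < a) (hb : 0 < b) {f g : ℂ} {k : ℝ}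
    (hk : dist f g < 2 * k) {T : Affine.Triangle ℝ ℂ}
    (h : IsPonceletTriangle (outerEllipse a b) (caustic a b f g k) T) :
    ((4 * k ^ 2 - dist f g ^ 2 : ℝ) : ℂ) = (1 - f * conj f) * (1 - g * conj g) ∧
    ∃ (l : ℂ) (z : Fin 3 → ℂ), ‖l‖ = 1 ∧ (∀ i, ‖z i‖ = 1) ∧ (∀ i, IsVertex f g l (z i)) ∧
      ∀ i, T.points i = scaling a b (z i) := by
  choose z hzT using fun i => scaling_surjective ha hb (T.points i)
  have hz : ∀ i, ‖z i‖ = 1 := fun i => by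
    rw [← scaling_mem_outerEllipse ha hb, hzT]; exact h.inscribed i
  have hne : ∀ i j, i ≠ j → z i ≠ z j := fun i j hij he =>
    hij (T.independent.injective (by rw [← hzT, ← hzT, he]))
  have ht : ∀ i j, i ≠ j →
      IsChordTangent f g ((4 * k ^ 2 - dist f g ^ 2 : ℝ) : ℂ) (z i) (z j) := by
    intro i j hij
    have := h.circumscribed i j hij
    rw [← hzT, ← hzT, caustic, isTangentLine_scaling_iff ha hb (hne i j hij),
      isTangentLine_focalEllipse_iff (hz i) (hz j) (hne i j hij) hk] at this
    exact this
  obtain ⟨h1, h2, h3, h4⟩ := minorAxis_sq_of_isChordTangent (ne_zero_of_norm_one (hz 0))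
    (hne 0 1 (by decide)) (hne 0 2 (by decide)) (hne 1 2 (by decide)) (ht 0 1 (by decide))
    (ht 0 2 (by decide)) (ht 1 2 (by decide))
  refine ⟨h1, z 0 * z 1 * z 2, z, by simp [hz], hz, ?_, fun i => (hzT i).symm⟩
  intro i
  fin_cases i
  exacts [h2, h3, h4]

theorem exists_ponceletTriangle {a b : ℝ} (ha : 0 < a) (hb : 0 < b) {f g : ℂ}
    {k : ℝ} (hk : dist f g < 2 * k) (hf : ‖f‖ < 1) (hg : ‖g‖ < 1)
    (hm : ((4 * k ^ 2 - dist f g ^ 2 : ℝ) : ℂ) = (1 - f * conj f) * (1 - g * conj g))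
    {l : ℂ} (hl : ‖l‖ = 1) :
    ∃ T : Affine.Triangle ℝ ℂ, IsPonceletTriangle (outerEllipse a b) (caustic a b f g k) T ∧
      ∃ z : Fin 3 → ℂ, (∀ i, ‖z i‖ = 1) ∧ (∀ i, IsVertex f g l (z i)) ∧
        ∀ i, T.points i = scaling a b (z i) := by
  obtain ⟨x, y, z, hx, hy, hz, hxy, hxz, hyz, vx, vy, vz⟩ := exists_isVertex hf hg hl
  have hn : ∀ i, ‖![x, y, z] i‖ = 1 := by intro i; fin_cases i; exacts [hx, hy, hz]
  have hv : ∀ i, IsVertex f g l (![x, y, z] i) := by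
    intro i; fin_cases i; exacts [vx, vy, vz]
  have hinj := scaling_injective ha hb
  -- Three distinct points of a circle are affinely independent, and the circle is the one from
  -- `exists_circle`.
  have hind : AffineIndependent ℝ ![scaling a b x, scaling a b y, scaling a b z] := by
    obtain ⟨d, ε, hd, hεd⟩ : ∃ d ε : ℝ, 0 < d ∧ ε * d = a ^ 2 - b ^ 2 :=
      ⟨1, a ^ 2 - b ^ 2, one_pos, mul_one _⟩
    obtain ⟨C, r, hC⟩ := exists_circle ha hb hd hεd f g l
    have key : ∀ v, ‖v‖ = 1 → IsVertex f g l v → dist (scaling a b v) C = √r := by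
      intro v hv1 hv2
      have := hC v
      rw [hv2.quadA_eq hv1, sub_self, mul_zero, sub_eq_zero] at this
      rw [← this, Real.sqrt_sq dist_nonneg]
    refine EuclideanGeometry.Cospherical.affineIndependent_of_ne ⟨C, √r, ?_⟩
      (hinj.ne hxy) (hinj.ne hxz) (hinj.ne hyz)
    rintro p (rfl | rfl | rfl)
    exacts [key x hx vx, key y hy vy, key z hz vz]
  obtain ⟨T, hpts⟩ : ∃ T : Affine.Triangle ℝ ℂ, ∀ i, T.points i = scaling a b (![x, y, z] i) :=
    ⟨⟨_, hind⟩, by intro i; fin_cases i <;> rfl⟩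
  refine ⟨T, ⟨fun i => ?_, fun i j hij => ?_⟩, ![x, y, z], hn, hv, hpts⟩
  · rw [hpts, scaling_mem_outerEllipse ha hb]; exact hn i
  · have hne : ![x, y, z] i ≠ ![x, y, z] j := by
      fin_cases i <;> fin_cases j <;> simp_all [eq_comm]
    rw [hpts, hpts, caustic, isTangentLine_scaling_iff ha hb hne,
      isTangentLine_focalEllipse_iff (hn i) (hn j) hne hk, hm]
    have c1 := vx.isChordTangent hf hg hz hxy hxz hyz vy vz
    have c2 := vx.isChordTangent hf hg hy hxz hxy hyz.symm vz vy
    have c3 := vy.isChordTangent hf hg hx hyz hxy.symm hxz.symm vz vx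
    fin_cases i <;> fin_cases j
    exacts [absurd rfl hij, c1, c2, c1.symm, absurd rfl hij, c3, c2.symm, c3.symm, absurd rfl hij]

theorem exists_unit_re_mul_eq {B : ℂ} {A : ℝ} :
    (∃ l : ℂ, ‖l‖ = 1 ∧ A = (conj l * B).re) ↔ |A| ≤ ‖B‖ := by
  constructor
  · rintro ⟨l, hl, rfl⟩
    refine (Complex.abs_re_le_norm _).trans ?_
    rw [norm_mul, Complex.norm_conj, hl, one_mul]
  · intro h
    -- The angle between l and B must have cosine A / ‖B‖. When B = 0, the bound forces A = 0 and
    -- the junk value of the quotient is harmless.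
    have hcos : ‖B‖ * Real.cos (Real.arccos (A / ‖B‖)) = A := by
      rcases eq_or_ne B 0 with rfl | hB
      · rw [norm_zero] at h ⊢
        rw [zero_mul, abs_nonpos_iff.1 h]
      · have hn := norm_pos_iff.2 hB
        obtain ⟨h1, h2⟩ := abs_le.1 h
        rw [Real.cos_arccos (by rw [le_div_iff₀ hn]; linarith) (by rw [div_le_one hn]; exact h2),
          mul_div_cancel₀ _ hn.ne']
    refine ⟨Complex.exp ((B.arg + Real.arccos (A / ‖B‖) : ℝ) * Complex.I),
      Complex.norm_exp_ofReal_mul_I _, ?_⟩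
    conv_rhs => rw [← Complex.norm_mul_exp_arg_mul_I B]
    rw [← Complex.exp_conj, mul_left_comm, ← Complex.exp_add]
    simp only [map_mul, Complex.conj_ofReal, Complex.conj_I, Complex.norm_mul_exp_arg_mul_I]
    rw [show ((B.arg + Real.arccos (A / ‖B‖) : ℝ) : ℂ) * -Complex.I + B.arg * Complex.I =
      ((-Real.arccos (A / ‖B‖) : ℝ) : ℂ) * Complex.I by push_cast; ring]
    rw [Complex.re_ofReal_mul, Complex.exp_ofReal_mul_I_re, Real.cos_neg, hcos]

theorem scaling_mem_sweptRegion_iff {a b d ε : ℝ} (ha : 0 < a) (hb : 0 < b)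
    (hd : 0 < d) (hε : ε ^ 2 = 1) (hεd : ε * d = a ^ 2 - b ^ 2) {f g : ℂ} {k : ℝ}
    (hk : dist f g < 2 * k) (hf : ‖f‖ < 1) (hg : ‖g‖ < 1)
    (hporism : ∃ T : Affine.Triangle ℝ ℂ,
      IsPonceletTriangle (outerEllipse a b) (caustic a b f g k) T) (w : ℂ) :
    scaling a b w ∈ sweptRegion (outerEllipse a b) (caustic a b f g k) ↔
      |quadA ((a ^ 2 + b ^ 2) / d) ε f g w| ≤ ‖linB f g w‖ := by
  obtain ⟨T₀, hT₀⟩ := hporism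
  have hm := (hT₀.exists_vertices ha hb hk).1
  have hεabs : |ε| = 1 := by
    rw [← sq_abs] at hε
    exact (pow_eq_one_iff_of_nonneg (abs_nonneg ε) two_ne_zero).1 hε
  have hB : ‖linB f g w‖ = ‖(ε : ℂ) * linB f g w‖ := by
    rw [norm_mul, Complex.norm_real, Real.norm_eq_abs, hεabs, one_mul]
  have hre : ∀ l : ℂ, (conj l * (ε * linB f g w)).re = ε * (conj l * linB f g w).re := by
    intro l
    rw [mul_left_comm, Complex.re_ofReal_mul]
  rw [hB, ← exists_unit_re_mul_eq]
  simp only [hre]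
  constructor
  · rintro ⟨T, hT, hw⟩
    obtain ⟨-, l, z, hl, hz, hv, hTz⟩ := hT.exists_vertices ha hb hk
    exact ⟨l, hl, (mem_circumsphere_iff_of_isVertex ha hb hd hεd hz hv hTz w).1 hw⟩
  · rintro ⟨l, hl, hw⟩
    obtain ⟨T, hT, z, hz, hv, hTz⟩ := exists_ponceletTriangle ha hb hk hf hg hm hl
    exact ⟨T, hT, (mem_circumsphere_iff_of_isVertex ha hb hd hεd hz hv hTz w).2 hw⟩

/-! ### Curves in polar form -/

/-- The positive root of `N * r ^ 2 - p * r - c`, for `0 < N` and `0 < c`. -/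
def posRoot (N p c : ℝ) : ℝ := (p + √(p ^ 2 + 4 * N * c)) / (2 * N)

theorem posRoot_pos {N p c : ℝ} (hN : 0 < N) (hc : 0 < c) : 0 < posRoot N p c := by
  have h : |p| < √(p ^ 2 + 4 * N * c) := by
    rw [← Real.sqrt_sq_eq_abs]
    exact Real.sqrt_lt_sqrt (sq_nonneg p) (by have := mul_pos hN hc; linarith)
  exact div_pos (by linarith [neg_abs_le p]) (by linarith)

theorem posRoot_eq {N p c : ℝ} (hN : 0 < N) (hc : 0 < c) :
    N * posRoot N p c ^ 2 - p * posRoot N p c - c = 0 := by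
  have h : √(p ^ 2 + 4 * N * c) ^ 2 = p ^ 2 + 4 * N * c := Real.sq_sqrt (by positivity)
  rw [posRoot]
  set q := √(p ^ 2 + 4 * N * c)
  field_simp
  linear_combination h

theorem eq_posRoot {N p c r : ℝ} (hN : 0 < N) (hc : 0 < c) (hr : 0 < r)
    (h : N * r ^ 2 - p * r - c = 0) : r = posRoot N p c := by
  have h1 := posRoot_pos (p := p) hN hc
  have h2 := posRoot_eq (p := p) hN hc
  set s := posRoot N p c
  -- Eliminating p from the two equations; the second factor is positive because the two roots of
  -- the quadratic have opposite signs.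
  have h3 : (r - s) * (N * r * s + c) = 0 := by linear_combination s * h - r * h2
  rcases mul_eq_zero.1 h3 with h4 | h4
  · linarith
  · have : 0 < N * r * s + c := by positivity
    linarith

theorem contDiff_posRoot {N p : ℝ → ℝ} {c : ℝ} (hN : ContDiff ℝ ∞ N) (hp : ContDiff ℝ ∞ p)
    (hN0 : ∀ t, 0 < N t) (hc : 0 < c) : ContDiff ℝ ∞ fun t => posRoot (N t) (p t) c := by
  unfold posRoot
  refine ContDiff.div (hp.add (ContDiff.sqrt ?_ fun t => ?_)) (contDiff_const.mul hN)
    fun t => ?_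
  · exact (hp.pow 2).add ((contDiff_const.mul hN).mul contDiff_const)
  · have := hN0 t
    positivity
  · have := hN0 t
    positivity

theorem hasDerivAt_exp_mul_I (θ : ℝ) : HasDerivAt (fun θ : ℝ => Complex.exp (θ * Complex.I))
    (Complex.exp (θ * Complex.I) * Complex.I) θ := by
  have h := ((hasDerivAt_id (θ : ℂ)).mul_const Complex.I).cexp.comp_ofReal
  simpa using h

theorem contDiff_exp_mul_I : ContDiff ℝ ∞ fun θ : ℝ => Complex.exp (θ * Complex.I) :=
  (Complex.ofRealCLM.contDiff.mul contDiff_const).cexp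

theorem exp_add_two_pi_mul_I (θ : ℝ) :
    Complex.exp (((θ + 2 * Real.pi : ℝ) : ℂ) * Complex.I) = Complex.exp (θ * Complex.I) := by
  rw [Complex.exp_eq_exp_iff_exists_int]
  exact ⟨1, by push_cast; ring⟩

theorem exp_mul_I_injOn :
    Set.InjOn (fun θ : ℝ => Complex.exp (θ * Complex.I)) (Set.Ico 0 (2 * Real.pi)) := by
  intro s hs t ht h
  obtain ⟨m, hm⟩ := Complex.exp_eq_exp_iff_exists_int.1 h
  have h1 : s = t + m * (2 * Real.pi) := by
    have : ((s : ℝ) : ℂ) = ((t + m * (2 * Real.pi) : ℝ) : ℂ) := by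
      apply mul_right_cancel₀ Complex.I_ne_zero
      rw [hm]; push_cast; ring
    exact_mod_cast this
  have hpi := Real.pi_pos
  have h2 : (m : ℝ) < 1 := by
    by_contra! hcon
    nlinarith [hs.2, ht.1]
  have h3 : (-1 : ℝ) < m := by
    by_contra! hcon
    nlinarith [hs.1, ht.2]
  have h4 : m < 1 := by exact_mod_cast h2
  have h5 : -1 < m := by exact_mod_cast h3
  have : m = 0 := by omega
  rw [h1, this]; simp

/-- The image under `u ↦ P + M u` of the curve with polar equation `r = ρ θ`. -/
def polarCurve (P : ℂ) (M : ℂ →L[ℝ] ℂ) (ρ : ℝ → ℝ) (θ : ℝ) : ℂ :=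
  P + M (ρ θ * Complex.exp (θ * Complex.I))

theorem hasDerivAt_polarCurve (P : ℂ) (M : ℂ →L[ℝ] ℂ) {ρ : ℝ → ℝ} (hρ : ContDiff ℝ ∞ ρ) (θ : ℝ) :
    HasDerivAt (polarCurve P M ρ)
      (M ((deriv ρ θ + ρ θ * Complex.I) * Complex.exp (θ * Complex.I))) θ := by
  have h1 : HasDerivAt ρ (deriv ρ θ) θ :=
    (hρ.differentiable (by simp)).differentiableAt.hasDerivAt
  have h2 := h1.ofReal_comp.mul (hasDerivAt_exp_mul_I θ)
  have h3 := (M.hasFDerivAt.comp_hasDerivAt θ h2).const_add P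
  have e : ((deriv ρ θ : ℝ) : ℂ) * Complex.exp (θ * Complex.I) +
      ρ θ * (Complex.exp (θ * Complex.I) * Complex.I) =
      (deriv ρ θ + ρ θ * Complex.I) * Complex.exp (θ * Complex.I) := by ring
  rw [e] at h3
  exact h3

theorem polarCurve_deriv_ne_zero {M : ℂ →L[ℝ] ℂ} (hM : Function.Injective M) {ρ : ℝ → ℝ}
    (hρ0 : ∀ θ, 0 < ρ θ) (θ : ℝ) :
    M ((deriv ρ θ + ρ θ * Complex.I) * Complex.exp (θ * Complex.I)) ≠ 0 := by
  rw [← M.map_zero]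
  apply hM.ne
  -- The imaginary part of ρ' + iρ is ρ > 0.
  refine mul_ne_zero (fun h => ?_) (Complex.exp_ne_zero _)
  have := congrArg Complex.im h
  simp at this
  linarith [hρ0 θ]

theorem isSmoothClosedCurve_polarCurve (P : ℂ) {M : ℂ →L[ℝ] ℂ} (hM : Function.Injective M)
    {ρ : ℝ → ℝ} (hρ : ContDiff ℝ ∞ ρ) (hρ0 : ∀ θ, 0 < ρ θ)
    (hper : Function.Periodic ρ (2 * Real.pi)) : IsSmoothClosedCurve (polarCurve P M ρ) where
  smooth := contDiff_const.add (M.contDiff.comp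
    ((Complex.ofRealCLM.contDiff.comp hρ).mul contDiff_exp_mul_I))
  periodic := fun θ => by rw [polarCurve, polarCurve, hper, exp_add_two_pi_mul_I]
  regular := fun θ => by
    rw [(hasDerivAt_polarCurve P M hρ θ).deriv]
    exact polarCurve_deriv_ne_zero hM hρ0 θ
  simple := by
    intro s hs t ht h
    have h1 := hM (add_left_cancel h)
    have h2 := congrArg norm h1
    rw [norm_mul, norm_mul, Complex.norm_exp_ofReal_mul_I, Complex.norm_exp_ofReal_mul_I,
      Complex.norm_real, Complex.norm_real, mul_one, mul_one, Real.norm_eq_abs, Real.norm_eq_abs,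
      abs_of_pos (hρ0 s), abs_of_pos (hρ0 t)] at h2
    rw [h2] at h1
    exact exp_mul_I_injOn hs ht
      (mul_left_cancel₀ (Complex.ofReal_ne_zero.2 (hρ0 t).ne') h1)

/-! ### The affine coordinate `linB` -/

theorem normSq_lt_one {z : ℂ} (hz : ‖z‖ < 1) : Complex.normSq z < 1 := by
  rw [Complex.normSq_eq_norm_sq]
  exact (sq_lt_one_iff₀ (norm_nonneg z)).2 hz

theorem norm_mul_lt_one {f g : ℂ} (hf : ‖f‖ < 1) (hg : ‖g‖ < 1) : ‖f * g‖ < 1 := by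
  rw [norm_mul]
  exact mul_lt_one_of_nonneg_of_lt_one_left (norm_nonneg f) hf hg.le

/-- The linear part of the inverse of `linB f g`. -/
def invLin (f g : ℂ) : ℂ →L[ℝ] ℂ :=
  (1 - Complex.normSq (f * g))⁻¹ •
    (ContinuousLinearMap.id ℝ ℂ - (f * g) • (Complex.conjCLE : ℂ →L[ℝ] ℂ))

theorem invLin_apply (f g u : ℂ) :
    invLin f g u = ((1 - Complex.normSq (f * g) : ℝ) : ℂ)⁻¹ * (u - f * g * conj u) := by
  simp [invLin]

/-- The zero of `linB f g`. -/
def linBZero (f g : ℂ) : ℂ := invLin f g (f + g)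

theorem one_sub_normSq_mul (f g : ℂ) :
    ((1 - Complex.normSq f * Complex.normSq g : ℝ) : ℂ) = 1 - f * g * (conj f * conj g) := by
  push_cast
  rw [← Complex.mul_conj, ← Complex.mul_conj]
  ring

theorem one_sub_normSq_mul_ne_zero {f g : ℂ} (hf : ‖f‖ < 1) (hg : ‖g‖ < 1) :
    ((1 - Complex.normSq f * Complex.normSq g : ℝ) : ℂ) ≠ 0 := by
  rw [Complex.ofReal_ne_zero, ← map_mul]
  linarith [normSq_lt_one (norm_mul_lt_one hf hg)]

theorem invLin_add_mul_conj {f g : ℂ} (hf : ‖f‖ < 1) (hg : ‖g‖ < 1) (u : ℂ) :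
    invLin f g u + f * g * conj (invLin f g u) = u := by
  have h := one_sub_normSq_mul_ne_zero hf hg
  rw [invLin_apply]
  simp only [map_mul, map_inv₀, Complex.conj_ofReal, map_sub, Complex.conj_conj]
  rw [one_sub_normSq_mul] at h ⊢
  linear_combination u * inv_mul_cancel₀ h

theorem invLin_linB_add {f g : ℂ} (hf : ‖f‖ < 1) (hg : ‖g‖ < 1) (w : ℂ) :
    linBZero f g + invLin f g (linB f g w) = w := by
  have h := one_sub_normSq_mul_ne_zero hf hg
  rw [linBZero, ← map_add, linB, invLin_apply]
  simp only [map_mul, map_sub, map_add, Complex.conj_conj]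
  rw [one_sub_normSq_mul] at h ⊢
  linear_combination w * inv_mul_cancel₀ h

theorem linB_add_invLin {f g : ℂ} (hf : ‖f‖ < 1) (hg : ‖g‖ < 1) (u : ℂ) :
    linB f g (linBZero f g + invLin f g u) = u := by
  have h1 := invLin_add_mul_conj hf hg (f + g)
  have h2 := invLin_add_mul_conj hf hg u
  rw [linB, map_add, linBZero]
  linear_combination h1 + h2

theorem linB_linBZero {f g : ℂ} (hf : ‖f‖ < 1) (hg : ‖g‖ < 1) : linB f g (linBZero f g) = 0 := by
  have := linB_add_invLin hf hg 0
  rwa [map_zero, add_zero] at this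

theorem invLin_injective {f g : ℂ} (hf : ‖f‖ < 1) (hg : ‖g‖ < 1) :
    Function.Injective (invLin f g) := by
  intro u v h
  rw [← invLin_add_mul_conj hf hg u, h, invLin_add_mul_conj hf hg v]

theorem norm_linBZero_lt_one {f g : ℂ} (hf : ‖f‖ < 1) (hg : ‖g‖ < 1) : ‖linBZero f g‖ < 1 := by
  have hfg := normSq_lt_one (norm_mul_lt_one hf hg)
  have hδ : 0 < 1 - Complex.normSq (f * g) := by linarith
  have e : f + g - f * g * conj (f + g) =
      ((1 - ‖g‖ ^ 2 : ℝ) : ℂ) * f + ((1 - ‖f‖ ^ 2 : ℝ) : ℂ) * g := by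
    rw [← Complex.normSq_eq_norm_sq, ← Complex.normSq_eq_norm_sq]
    push_cast
    rw [← Complex.mul_conj, ← Complex.mul_conj, map_add]
    ring
  rw [linBZero, invLin_apply, e, ← Complex.ofReal_inv, norm_mul, Complex.norm_real,
    Real.norm_eq_abs, abs_of_pos (inv_pos.2 hδ), inv_mul_lt_one₀ hδ]
  have f0 := norm_nonneg f
  have g0 := norm_nonneg g
  refine (norm_add_le _ _).trans_lt ?_
  rw [norm_mul, norm_mul, Complex.norm_real, Complex.norm_real, Real.norm_eq_abs,
    Real.norm_eq_abs, abs_of_pos (by nlinarith), abs_of_pos (by nlinarith), map_mul,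
    Complex.normSq_eq_norm_sq, Complex.normSq_eq_norm_sq]
  -- With F = ‖f‖ and G = ‖g‖, the gap in the inequality factors as (1 - FG)(1 - F)(1 - G).
  have h1 : 0 < (1 - ‖f‖) * (1 - ‖g‖) := mul_pos (by linarith) (by linarith)
  have h2 : 0 < 1 - ‖f‖ * ‖g‖ := by nlinarith
  nlinarith [mul_pos h1 h2]

/-- The quadratic part of `quadA` in the coordinate `linB`. -/
def quadPart (K ε : ℝ) (f g u : ℂ) : ℝ :=
  (K + ε) * (invLin f g u).re ^ 2 + (K - ε) * (invLin f g u).im ^ 2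

/-- The linear part of `quadA` in the coordinate `linB`. -/
def linPart (K ε : ℝ) (f g u : ℂ) : ℝ :=
  2 * K * ((linBZero f g).re * (invLin f g u).re + (linBZero f g).im * (invLin f g u).im) +
    ε * ((2 * linBZero f g - (f + g)).re * (invLin f g u).re -
      (2 * linBZero f g - (f + g)).im * (invLin f g u).im)

theorem quadA_add_invLin (K ε : ℝ) (f g u : ℂ) (t : ℝ) :
    quadA K ε f g (linBZero f g + invLin f g (t * u)) =
      quadPart K ε f g u * t ^ 2 + linPart K ε f g u * t + quadA K ε f g (linBZero f g) := by
  have : invLin f g (t * u) = t * invLin f g u := by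
    rw [← Complex.real_smul, map_smul, Complex.real_smul]
  rw [this]
  simp only [quadA, quadPart, linPart, Complex.normSq_apply, Complex.add_re, Complex.add_im,
    Complex.sub_re, Complex.sub_im, Complex.mul_re, Complex.mul_im, Complex.ofReal_re,
    Complex.ofReal_im, Complex.re_ofNat, Complex.im_ofNat]
  ring

theorem quadPart_nonneg {K ε : ℝ} (hK : |ε| < K) (f g u : ℂ) : 0 ≤ quadPart K ε f g u := by
  obtain ⟨h1, h2⟩ := abs_lt.1 hK
  exact add_nonneg (mul_nonneg (by linarith) (sq_nonneg _)) (mul_nonneg (by linarith) (sq_nonneg _))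

theorem quadPart_pos {K ε : ℝ} (hK : |ε| < K) {f g u : ℂ} (hf : ‖f‖ < 1) (hg : ‖g‖ < 1)
    (hu : u ≠ 0) : 0 < quadPart K ε f g u := by
  obtain ⟨h1, h2⟩ := abs_lt.1 hK
  have h0 : invLin f g u ≠ 0 := by
    rw [← (invLin f g).map_zero]
    exact (invLin_injective hf hg).ne hu
  unfold quadPart
  have hp : 0 < K + ε := by linarith
  have hm : 0 < K - ε := by linarith
  by_cases hr : (invLin f g u).re = 0
  · have hi : (invLin f g u).im ≠ 0 := fun hi => h0 (Complex.ext hr hi)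
    positivity
  · positivity

theorem mul_sub_eq (f g w : ℂ) : (w - f) * (w - g) =
    w * linB f g w + f * g * ((1 - Complex.normSq w : ℝ) : ℂ) := by
  push_cast
  rw [← Complex.mul_conj, linB]
  ring

/-- Extends A = ε Re(wB) off the unit circle with a correction whose sign is that of |w|² - 1; it
controls both the sign of A at the zero of B and the side on which A = |B| lies. -/
theorem quadA_eq (K ε : ℝ) (f g w : ℂ) : quadA K ε f g w =
    ε * (w * linB f g w).re - (K - ε * (f * g).re) * (1 - Complex.normSq w) := by
  rw [quadA, mul_sub_eq, Complex.add_re, Complex.re_mul_ofReal]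
  ring

theorem sub_mul_re_pos {K ε : ℝ} (hK : |ε| < K) {f g : ℂ} (hf : ‖f‖ < 1) (hg : ‖g‖ < 1) :
    0 < K - ε * (f * g).re := by
  have h1 := (Complex.abs_re_le_norm (f * g)).trans (norm_mul_lt_one hf hg).le
  have h2 : ε * (f * g).re ≤ |ε| := by
    refine (le_abs_self _).trans ?_
    rw [abs_mul]
    exact mul_le_of_le_one_right (abs_nonneg _) h1
  linarith

theorem quadA_linBZero_neg {K ε : ℝ} (hK : |ε| < K) {f g : ℂ} (hf : ‖f‖ < 1) (hg : ‖g‖ < 1) :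
    quadA K ε f g (linBZero f g) < 0 := by
  rw [quadA_eq, linB_linBZero hf hg, mul_zero, Complex.zero_re, mul_zero]
  have h1 := normSq_lt_one (norm_linBZero_lt_one hf hg)
  have := mul_pos (sub_mul_re_pos hK hf hg) (by linarith : 0 < 1 - Complex.normSq (linBZero f g))
  linarith

/-! ### The two components of the envelope -/

/-- The polar equation, in the coordinate `linB`, of the component `quadA = τ * ‖linB‖` of the
envelope. -/
def envelopeRadius (K ε τ : ℝ) (f g : ℂ) (θ : ℝ) : ℝ :=
  posRoot (quadPart K ε f g (Complex.exp (θ * Complex.I)))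
    (τ - linPart K ε f g (Complex.exp (θ * Complex.I))) (-quadA K ε f g (linBZero f g))

theorem envelopeRadius_pos {K ε : ℝ} (hK : |ε| < K) {f g : ℂ} (hf : ‖f‖ < 1) (hg : ‖g‖ < 1)
    (τ θ : ℝ) : 0 < envelopeRadius K ε τ f g θ :=
  posRoot_pos (quadPart_pos hK hf hg (Complex.exp_ne_zero _))
    (neg_pos.2 (quadA_linBZero_neg hK hf hg))

theorem periodic_envelopeRadius (K ε τ : ℝ) (f g : ℂ) :
    Function.Periodic (envelopeRadius K ε τ f g) (2 * Real.pi) := by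
  intro θ
  rw [envelopeRadius, exp_add_two_pi_mul_I, envelopeRadius]

theorem contDiff_envelopeRadius {K ε : ℝ} (hK : |ε| < K) {f g : ℂ} (hf : ‖f‖ < 1)
    (hg : ‖g‖ < 1) (τ : ℝ) : ContDiff ℝ ∞ (envelopeRadius K ε τ f g) := by
  have h := (invLin f g).contDiff.comp contDiff_exp_mul_I
  have hre : ContDiff ℝ ∞ fun θ : ℝ => (invLin f g (Complex.exp (θ * Complex.I))).re :=
    Complex.reCLM.contDiff.comp h
  have him : ContDiff ℝ ∞ fun θ : ℝ => (invLin f g (Complex.exp (θ * Complex.I))).im :=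
    Complex.imCLM.contDiff.comp h
  refine contDiff_posRoot ?_ ?_ (fun θ => quadPart_pos hK hf hg (Complex.exp_ne_zero _))
    (neg_pos.2 (quadA_linBZero_neg hK hf hg))
  · unfold quadPart
    fun_prop
  · unfold linPart
    fun_prop

theorem range_polarCurve_envelopeRadius {K ε : ℝ} (hK : |ε| < K) {f g : ℂ} (hf : ‖f‖ < 1)
    (hg : ‖g‖ < 1) (τ : ℝ) :
    Set.range (polarCurve (linBZero f g) (invLin f g) (envelopeRadius K ε τ f g)) =
      {w | quadA K ε f g w = τ * ‖linB f g w‖} := by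
  have hc := neg_pos.2 (quadA_linBZero_neg hK hf hg)
  ext w
  constructor
  · rintro ⟨θ, rfl⟩
    change quadA _ _ _ _ _ = _
    have hρ := envelopeRadius_pos hK hf hg τ θ
    rw [polarCurve, linB_add_invLin hf hg, quadA_add_invLin, norm_mul,
      Complex.norm_exp_ofReal_mul_I, Complex.norm_real, Real.norm_eq_abs, abs_of_pos hρ, mul_one]
    have := posRoot_eq (p := τ - linPart K ε f g (Complex.exp (θ * Complex.I)))
      (quadPart_pos hK hf hg (Complex.exp_ne_zero (θ * Complex.I))) hc
    rw [← envelopeRadius] at this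
    linarith
  · intro hw
    change quadA _ _ _ _ _ = _ at hw
    set u := linB f g w with hu
    have hwu : linBZero f g + invLin f g u = w := invLin_linB_add hf hg w
    have hu0 : u ≠ 0 := by
      intro h0
      rw [h0, map_zero, add_zero] at hwu
      rw [h0, ← hwu, norm_zero, mul_zero] at hw
      linarith
    refine ⟨u.arg, ?_⟩
    have hq := quadA_add_invLin K ε f g (Complex.exp (u.arg * Complex.I)) ‖u‖
    rw [Complex.norm_mul_exp_arg_mul_I, hwu, hw] at hq
    have := eq_posRoot (p := τ - linPart K ε f g (Complex.exp (u.arg * Complex.I)))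
      (quadPart_pos hK hf hg (Complex.exp_ne_zero (u.arg * Complex.I))) hc (norm_pos_iff.2 hu0)
      (by linarith)
    rw [polarCurve, envelopeRadius, ← this, Complex.norm_mul_exp_arg_mul_I, hwu]

theorem continuous_linB (f g : ℂ) : Continuous (linB f g) := by
  unfold linB
  fun_prop

theorem continuous_quadA (K ε : ℝ) (f g : ℂ) : Continuous (quadA K ε f g) := by
  have := Complex.continuous_normSq
  unfold quadA
  fun_prop

/-- Along the ray the difference is a quadratic in t with root 1, so it factors. For t ≥ 0 the
second factor is positive, since `quadA` is negative at the zero of `linB`. -/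
theorem quadA_ray {K ε τ : ℝ} {f g w : ℂ} (hf : ‖f‖ < 1) (hg : ‖g‖ < 1)
    (hw : quadA K ε f g w = τ * ‖linB f g w‖) (t : ℝ) :
    quadA K ε f g (linBZero f g + invLin f g (t * linB f g w)) - τ * (t * ‖linB f g w‖) =
      (t - 1) * (t * quadPart K ε f g (linB f g w) - quadA K ε f g (linBZero f g)) := by
  have h1 := quadA_add_invLin K ε f g (linB f g w) 1
  rw [Complex.ofReal_one, one_mul, invLin_linB_add hf hg, hw] at h1
  rw [quadA_add_invLin]
  linear_combination (-t) * h1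

theorem frontier_abs_quadA_le {K ε : ℝ} (hK : |ε| < K) {f g : ℂ} (hf : ‖f‖ < 1) (hg : ‖g‖ < 1) :
    frontier {w | |quadA K ε f g w| ≤ ‖linB f g w‖} =
      {w | |quadA K ε f g w| = ‖linB f g w‖} := by
  have hA := (continuous_quadA K ε f g).abs
  have hB := (continuous_linB f g).norm
  apply (frontier_le_subset_eq hA hB).antisymm
  intro w hw
  change |quadA K ε f g w| = _ at hw
  rw [frontier_eq_closure_inter_closure]
  refine ⟨subset_closure hw.le, ?_⟩
  set u := linB f g w with hu
  have hN := quadPart_nonneg hK f g u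
  have hc := quadA_linBZero_neg hK hf hg
  set path : ℝ → ℂ := fun t => linBZero f g + invLin f g (t * u) with hpath
  have hcont : Continuous path := by
    have := (invLin f g).continuous
    fun_prop
  have h1 : path 1 = w := by
    rw [hpath]; simp only; rw [Complex.ofReal_one, one_mul, invLin_linB_add hf hg]
  have hnorm : ∀ t : ℝ, 0 < t → ‖linB f g (path t)‖ = t * ‖u‖ := by
    intro t ht
    rw [hpath, linB_add_invLin hf hg, norm_mul, Complex.norm_real, Real.norm_eq_abs,
      abs_of_pos ht]
  have htend : Filter.Tendsto path (nhds 1) (nhds w) := h1 ▸ hcont.tendsto 1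
  rcases abs_choice (quadA K ε f g w) with h | h
  · have hw' : quadA K ε f g w = 1 * ‖linB f g w‖ := by rw [one_mul, ← hw, h]
    -- On A = |B|, moving outwards along the ray makes A exceed |B|.
    refine mem_closure_of_tendsto (htend.mono_left (nhdsWithin_le_nhds (s := Set.Ioi 1))) ?_
    filter_upwards [self_mem_nhdsWithin] with t ht
    have ht1 : 1 < t := ht
    have key := quadA_ray hf hg hw' t
    have : 0 < (t - 1) * (t * quadPart K ε f g u - quadA K ε f g (linBZero f g)) :=
      mul_pos (by linarith) (by nlinarith)
    change ¬ |quadA K ε f g (path t)| ≤ ‖linB f g (path t)‖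
    rw [not_le, hnorm t (by linarith)]
    refine lt_of_lt_of_le ?_ (le_abs_self _)
    simp only [hpath]
    linarith
  · have hw' : quadA K ε f g w = -1 * ‖linB f g w‖ := by rw [← hu, ← hw, h]; ring
    -- On A = -|B|, moving inwards makes A drop below -|B|.
    refine mem_closure_of_tendsto (htend.mono_left (nhdsWithin_le_nhds (s := Set.Iio 1))) ?_
    filter_upwards [self_mem_nhdsWithin, mem_nhdsWithin_of_mem_nhds (lt_mem_nhds one_pos)]
      with t ht ht0
    have ht1 : t < 1 := ht
    have key := quadA_ray hf hg hw' t
    have : (t - 1) * (t * quadPart K ε f g u - quadA K ε f g (linBZero f g)) < 0 :=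
      mul_neg_of_neg_of_pos (by linarith) (by nlinarith)
    change ¬ |quadA K ε f g (path t)| ≤ ‖linB f g (path t)‖
    rw [not_le, hnorm t ht0]
    refine lt_of_lt_of_le ?_ (neg_le_abs _)
    simp only [hpath]
    linarith

theorem abs_quadA_le_of_norm_one {K ε : ℝ} (hε : |ε| = 1) {f g w : ℂ} (hw : ‖w‖ = 1) :
    |quadA K ε f g w| ≤ ‖linB f g w‖ := by
  rw [quadA_of_norm_one hw, abs_mul, hε, one_mul, ← mul_linB_of_norm_one hw]
  refine (Complex.abs_re_le_norm _).trans ?_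
  rw [norm_mul, hw, one_mul]

theorem one_le_norm_of_quadA_eq {K ε : ℝ} (hε : |ε| = 1) (hK : |ε| < K) {f g w : ℂ}
    (hf : ‖f‖ < 1) (hg : ‖g‖ < 1) (h : quadA K ε f g w = 1 * ‖linB f g w‖) : 1 ≤ ‖w‖ := by
  by_contra! hw
  rw [quadA_eq] at h
  have h1 : ε * (w * linB f g w).re ≤ ‖w‖ * ‖linB f g w‖ := by
    refine (le_abs_self _).trans ?_
    rw [abs_mul, hε, one_mul, ← norm_mul]
    exact Complex.abs_re_le_norm _
  have h2 := mul_pos (sub_mul_re_pos hK hf hg) (sub_pos.2 (normSq_lt_one hw))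
  nlinarith [norm_nonneg (linB f g w)]

/-- The ray to a point outside the disc starts inside it, so it crosses the unit circle at some t <
1. There `quadA_ray` gives A < -|B|, contradicting |A| ≤ |B| on the circle. -/
theorem norm_le_one_of_quadA_eq {K ε : ℝ} (hε : |ε| = 1) (hK : |ε| < K) {f g w : ℂ}
    (hf : ‖f‖ < 1) (hg : ‖g‖ < 1) (h : quadA K ε f g w = -1 * ‖linB f g w‖) : ‖w‖ ≤ 1 := by
  by_contra! hw
  set path : ℝ → ℂ := fun t => linBZero f g + invLin f g (t * linB f g w) with hpath
  have hcont : Continuous fun t => ‖path t‖ := by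
    have := (invLin f g).continuous
    fun_prop
  have h0 : ‖path 0‖ < 1 := by
    simp only [hpath, Complex.ofReal_zero, zero_mul, map_zero, add_zero]
    exact norm_linBZero_lt_one hf hg
  have h1 : path 1 = w := by
    simp only [hpath]; rw [Complex.ofReal_one, one_mul, invLin_linB_add hf hg]
  obtain ⟨t, ⟨ht0, ht1⟩, ht⟩ := intermediate_value_Ioo zero_le_one hcont.continuousOn
    (show (1 : ℝ) ∈ Set.Ioo ‖path 0‖ ‖path 1‖ from ⟨h0, h1 ▸ hw⟩)
  simp only at ht
  have key := quadA_ray hf hg h t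
  have hneg : (t - 1) * (t * quadPart K ε f g (linB f g w) - quadA K ε f g (linBZero f g)) < 0 :=
    mul_neg_of_neg_of_pos (by linarith)
      (by nlinarith [quadPart_nonneg hK f g (linB f g w), quadA_linBZero_neg hK hf hg])
  have hle := (abs_le.1 (abs_quadA_le_of_norm_one (K := K) (f := f) (g := g) hε ht)).1
  have hn : ‖linB f g (path t)‖ = t * ‖linB f g w‖ := by
    simp only [hpath]
    rw [linB_add_invLin hf hg, norm_mul, Complex.norm_real, Real.norm_eq_abs, abs_of_pos ht0]
  rw [hn] at hle
  simp only [hpath] at hle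
  linarith

/-! ### Points of contact with the outer ellipse -/

theorem card_le_four_of_quartic {f g : ℂ} (S : Finset ℂ)
    (hS : ∀ w ∈ S, w ^ 2 * ((w - f) * (w - g)) = (1 - conj f * w) * (1 - conj g * w)) :
    S.card ≤ 4 := by
  set p : Polynomial ℂ := Polynomial.X ^ 2 * ((Polynomial.X - Polynomial.C f) *
    (Polynomial.X - Polynomial.C g)) - (1 - Polynomial.C (conj f) * Polynomial.X) *
    (1 - Polynomial.C (conj g) * Polynomial.X) with hp
  have hdeg : p.natDegree = 4 := by rw [hp]; compute_degree!
  rw [← hdeg]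
  apply Polynomial.card_le_degree_of_subset_roots
  intro w hw
  rw [Finset.mem_val] at hw
  rw [Polynomial.mem_roots (Polynomial.ne_zero_of_natDegree_gt (n := 0) (by rw [hdeg]; norm_num)),
    Polynomial.IsRoot.def, hp]
  simp [hS w hw]

theorem quartic_of_re_eq {f g w : ℂ} (hw : ‖w‖ = 1)
    (h : |((w - f) * (w - g)).re| = ‖(w - f) * (w - g)‖) :
    w ^ 2 * ((w - f) * (w - g)) = (1 - conj f * w) * (1 - conj g * w) := by
  have him : ((w - f) * (w - g)).im = 0 := by
    rw [Complex.abs_re_eq_norm] at h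
    exact h
  have hc := Complex.conj_eq_iff_im.2 him
  have hw0 := ne_zero_of_norm_one hw
  rw [← hc, map_mul, map_sub, map_sub, conj_eq_inv_of_norm_one hw]
  field_simp

theorem exists_contact_points {f g : ℂ} (hf : ‖f‖ < 1) (hg : ‖g‖ < 1) {s : ℝ}
    (hs : s = 1 ∨ s = -1) : ∃ p q : ℂ, p ≠ q ∧ ‖p‖ = 1 ∧ ‖q‖ = 1 ∧
      ((p - f) * (p - g)).re = s * ‖(p - f) * (p - g)‖ ∧
      ((q - f) * (q - g)).re = s * ‖(q - f) * (q - g)‖ ∧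
      ∀ w : ℂ, ‖w‖ = 1 → ((w - f) * (w - g)).re = s * ‖(w - f) * (w - g)‖ → w = p ∨ w = q := by
  set ψ : ℝ → ℝ := fun θ => 2 * phase f g θ with hψ
  have hsurj : Function.Surjective ψ := by
    refine surjective_of_bounded_sub_linear (n := 4) (M := 4 * Real.pi) ?_ (by norm_num) ?_
    · exact continuous_const.mul (continuous_phase hf hg)
    · intro θ
      have := abs_phase_sub_le f g θ
      rw [hψ, show (fun θ => 2 * phase f g θ) θ - 4 * θ = 2 * (phase f g θ - 2 * θ) by
        simp only; ring, abs_mul, abs_two]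
      linarith
  -- These are the angles where `phase` equals jπ, so (z - f)(z - g) is real with sign (-1)^j. A
  -- fifth such point would exceed the degree of the quartic.
  choose θ hθ using fun j : Fin 4 => hsurj (0 + 2 * Real.pi * (j : ℕ))
  have hinj := exp_injective_of_phase (ψ := ψ) (n := 4) (by
    intro θ m
    simp only [hψ, phase_add]
    push_cast
    ring) hθ
  set z : Fin 4 → ℂ := fun j => Complex.exp (θ j * Complex.I) with hz
  have hz1 : ∀ j, ‖z j‖ = 1 := fun j => Complex.norm_exp_ofReal_mul_I (θ j)
  have hre : ∀ j, ((z j - f) * (z j - g)).re = (-1) ^ (j : ℕ) * ‖(z j - f) * (z j - g)‖ := by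
    intro j
    have h1 := mul_sub_eq_norm_mul_exp_phase (f := f) (g := g) (θ j)
    have h2 : phase f g (θ j) = (j : ℕ) * Real.pi := by
      have := hθ j
      simp only [hψ] at this
      linarith
    have h3 := congrArg Complex.re h1
    rw [Complex.re_ofReal_mul, Complex.exp_ofReal_mul_I_re, h2, Real.cos_nat_mul_pi] at h3
    rw [mul_comm ((-1) ^ (j : ℕ))]
    exact h3
  have hpos : ∀ w : ℂ, ‖w‖ = 1 → 0 < ‖(w - f) * (w - g)‖ := fun w hw =>
    norm_pos_iff.2 (mul_ne_zero (sub_ne_zero_of_norm hf hw) (sub_ne_zero_of_norm hg hw))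
  have habs : |s| = 1 := by rcases hs with rfl | rfl <;> simp
  have hmem : ∀ w : ℂ, ‖w‖ = 1 → ((w - f) * (w - g)).re = s * ‖(w - f) * (w - g)‖ →
      ∃ j, w = z j := by
    intro w hw hws
    by_contra! hcon
    have hcard := card_le_four_of_quartic (f := f) (g := g) (insert w (Finset.univ.image z)) (by
      intro v hv
      rw [Finset.mem_insert, Finset.mem_image] at hv
      rcases hv with rfl | ⟨j, -, rfl⟩
      · apply quartic_of_re_eq hw
        rw [hws, abs_mul, habs, one_mul, abs_norm]
      · apply quartic_of_re_eq (hz1 j)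
        rw [hre, abs_mul, abs_pow, abs_neg, abs_one, one_pow, one_mul, abs_norm])
    rw [Finset.card_insert_of_notMem (by simpa [eq_comm] using hcon),
      Finset.card_image_of_injective _ hinj, Finset.card_univ, Fintype.card_fin] at hcard
    omega
  have hsign : ∀ j, ((z j - f) * (z j - g)).re = s * ‖(z j - f) * (z j - g)‖ →
      s = (-1) ^ (j : ℕ) := fun j hj =>
    mul_right_cancel₀ (hpos _ (hz1 j)).ne' (by rw [← hj, hre])
  rcases hs with rfl | rfl
  · refine ⟨z 0, z 2, fun h => absurd (hinj h) (by decide), hz1 0, hz1 2, by simpa using hre 0,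
      by simpa using hre 2, fun w hw hws => ?_⟩
    obtain ⟨j, rfl⟩ := hmem w hw hws
    have := hsign j hws
    fin_cases j <;> first | exact Or.inl rfl | exact Or.inr rfl | norm_num at this
  · refine ⟨z 1, z 3, fun h => absurd (hinj h) (by decide), hz1 1, hz1 3, by simpa using hre 1,
      ?_, fun w hw hws => ?_⟩
    · have := hre 3
      norm_num at this ⊢
      linarith
    · obtain ⟨j, rfl⟩ := hmem w hw hws
      have := hsign j hws
      fin_cases j <;> first | exact Or.inl rfl | exact Or.inr rfl | norm_num at this

theorem hasDerivAt_normSq {η : ℝ → ℂ} {v : ℂ} {t : ℝ} (h : HasDerivAt η v t) :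
    HasDerivAt (fun s => Complex.normSq (η s)) (2 * ((η t).re * v.re + (η t).im * v.im)) t := by
  have hre : HasDerivAt (fun s => (η s).re) v.re t :=
    Complex.reCLM.hasFDerivAt.comp_hasDerivAt t h
  have him : HasDerivAt (fun s => (η s).im) v.im t :=
    Complex.imCLM.hasFDerivAt.comp_hasDerivAt t h
  have := (hre.mul hre).add (him.mul him)
  simp only [Complex.normSq_apply]
  exact this.congr_deriv (by ring)

/-- `scaling` as a continuous linear map. -/
def scalingL (a b : ℝ) : ℂ →L[ℝ] ℂ :=
  LinearMap.toContinuousLinearMap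
    { toFun := scaling a b
      map_add' := fun z w => by apply Complex.ext <;> simp [scaling_re, scaling_im] <;> ring
      map_smul' := fun c z => by apply Complex.ext <;> simp [scaling_re, scaling_im] <;> ring }

theorem scalingL_apply (a b : ℝ) (z : ℂ) : scalingL a b z = scaling a b z := rfl

/-- At an extremum of |η|² the velocity v is orthogonal to η, so |η + cv|² = 1 + c²|v|² equals 1
only for c = 0. Affine scaling preserves the single intersection. -/
theorem isTangentAt_of_hasDerivAt {a b : ℝ} (ha : 0 < a) (hb : 0 < b) {η : ℝ → ℂ} {v : ℂ} {t : ℝ}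
    (h : HasDerivAt η v t) (hv : v ≠ 0) (hη : ‖η t‖ = 1)
    (hext : IsLocalExtr (fun s => Complex.normSq (η s)) t) :
    IsTangentAt (fun s => scaling a b (η s)) (outerEllipse a b) (scaling a b (η t)) := by
  have horth := hext.hasDerivAt_eq_zero (hasDerivAt_normSq h)
  have hd : HasDerivAt (fun s => scaling a b (η s)) (scaling a b v) t :=
    (scalingL a b).hasFDerivAt.comp_hasDerivAt t h
  have hmem := (scaling_mem_outerEllipse ha hb).2 hη
  refine ⟨hmem, t, rfl, ?_, ?_⟩
  · rw [hd.deriv, ← scalingL_apply, ← (scalingL a b).map_zero]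
    exact (scaling_injective ha hb).ne hv
  · rw [hd.deriv]
    refine ⟨scaling a b (η t), ⟨AffineSubspace.self_mem_mk' _ _, hmem⟩, ?_⟩
    rintro p ⟨hp, hpE⟩
    rw [AffineSubspace.mem_mk', Submodule.mem_span_singleton] at hp
    obtain ⟨c, hc⟩ := hp
    have hp2 : p = scaling a b (η t + c * v) := by
      rw [scaling_add_mul, ← Complex.real_smul, hc, vsub_eq_sub]
      ring
    rw [hp2, scaling_mem_outerEllipse ha hb] at hpE
    have h1 := normSq_eq_one hpE
    have h2 := normSq_eq_one hη
    have hv2 := Complex.normSq_pos.2 hv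
    rw [Complex.normSq_apply] at h1 h2 hv2
    simp only [Complex.add_re, Complex.add_im, Complex.re_ofReal_mul, Complex.im_ofReal_mul] at h1
    have h3 : c ^ 2 * (v.re * v.re + v.im * v.im) = 0 := by
      linear_combination h1 - h2 - c * horth
    have h4 : c = 0 := by
      rcases mul_eq_zero.1 h3 with h4 | h4
      · exact pow_eq_zero_iff two_ne_zero |>.1 h4
      · linarith
    rw [hp2, h4]
    simp

/-- The components of the envelope. -/
def envelopeCurve (a b K ε τ : ℝ) (f g : ℂ) (θ : ℝ) : ℂ :=
  scaling a b (polarCurve (linBZero f g) (invLin f g) (envelopeRadius K ε τ f g) θ)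

theorem isSmoothClosedCurve_envelopeCurve {a b K ε : ℝ} (ha : 0 < a) (hb : 0 < b) (hK : |ε| < K)
    {f g : ℂ} (hf : ‖f‖ < 1) (hg : ‖g‖ < 1) (τ : ℝ) :
    IsSmoothClosedCurve (envelopeCurve a b K ε τ f g) := by
  have : envelopeCurve a b K ε τ f g = polarCurve (scaling a b (linBZero f g))
      ((scalingL a b).comp (invLin f g)) (envelopeRadius K ε τ f g) := by
    funext θ
    rw [envelopeCurve, polarCurve, ← scalingL_apply, map_add]
    rfl
  rw [this]
  exact isSmoothClosedCurve_polarCurve _ ((scaling_injective ha hb).comp (invLin_injective hf hg))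
    (contDiff_envelopeRadius hK hf hg τ) (envelopeRadius_pos hK hf hg τ)
    (periodic_envelopeRadius K ε τ f g)

theorem range_envelopeCurve {a b K ε : ℝ} (hK : |ε| < K) {f g : ℂ} (hf : ‖f‖ < 1)
    (hg : ‖g‖ < 1) (τ : ℝ) : Set.range (envelopeCurve a b K ε τ f g) =
      scaling a b '' {w | quadA K ε f g w = τ * ‖linB f g w‖} := by
  rw [← range_polarCurve_envelopeRadius hK hf hg, ← Set.range_comp]
  rfl

/-- The set `side` of admissible norms treats the outer and inner curve together: confinement to one
side of the unit circle makes each contact a global extremum of |η|², hence a tangency. -/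
theorem isTangentAtTwoPointsFrom_envelopeCurve {a b K ε τ : ℝ} (ha : 0 < a) (hb : 0 < b)
    (hε : ε = 1 ∨ ε = -1) (hτ : τ = 1 ∨ τ = -1) (hK : 1 < K) {f g : ℂ} (hf : ‖f‖ < 1)
    (hg : ‖g‖ < 1) {side : Set ℝ} {S : Set ℂ}
    (hside : (∀ r ∈ side, 1 ≤ r) ∨ ∀ r ∈ side, r ≤ 1)
    (hmem : ∀ w, quadA K ε f g w = τ * ‖linB f g w‖ → ‖w‖ ∈ side)
    (hS : ∀ w : ℂ, ‖w‖ ∈ side → ‖w‖ ≠ 1 → scaling a b w ∈ S) :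
    IsTangentAtTwoPointsFrom S (envelopeCurve a b K ε τ f g) (outerEllipse a b) := by
  have hεabs : |ε| = 1 := by rcases hε with rfl | rfl <;> simp
  have hKε : |ε| < K := hεabs ▸ hK
  have hετ : ε * τ = 1 ∨ ε * τ = -1 := by
    rcases hε with rfl | rfl <;> rcases hτ with rfl | rfl <;> norm_num
  have hεε : ε * ε = 1 := by rcases hε with rfl | rfl <;> norm_num
  have hiff : ∀ w : ℂ, ‖w‖ = 1 → (quadA K ε f g w = τ * ‖linB f g w‖ ↔
      ((w - f) * (w - g)).re = ε * τ * ‖(w - f) * (w - g)‖) := by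
    intro w hw
    have : ‖linB f g w‖ = ‖(w - f) * (w - g)‖ := by
      rw [← mul_linB_of_norm_one hw, norm_mul, hw, one_mul]
    rw [quadA_of_norm_one hw, this]
    constructor
    · intro h
      linear_combination ε * h - ((w - f) * (w - g)).re * hεε
    · intro h
      linear_combination ε * h + τ * ‖(w - f) * (w - g)‖ * hεε
  set η := polarCurve (linBZero f g) (invLin f g) (envelopeRadius K ε τ f g) with hη
  have hrange := range_polarCurve_envelopeRadius hKε hf hg τ
  rw [← hη] at hrange
  have hηmem : ∀ t, quadA K ε f g (η t) = τ * ‖linB f g (η t)‖ := fun t => by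
    have : η t ∈ Set.range η := ⟨t, rfl⟩
    rwa [hrange] at this
  have htan : ∀ w : ℂ, ‖w‖ = 1 → quadA K ε f g w = τ * ‖linB f g w‖ →
      IsTangentAt (envelopeCurve a b K ε τ f g) (outerEllipse a b) (scaling a b w) := by
    intro w hw hwA
    obtain ⟨t, rfl⟩ : w ∈ Set.range η := by rw [hrange]; exact hwA
    refine isTangentAt_of_hasDerivAt ha hb
      (hasDerivAt_polarCurve _ _ (contDiff_envelopeRadius hKε hf hg τ) t)
      (polarCurve_deriv_ne_zero (invLin_injective hf hg) (envelopeRadius_pos hKε hf hg τ) t) hw ?_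
    have hsq : ∀ s, Complex.normSq (η s) = ‖η s‖ ^ 2 := fun s => Complex.normSq_eq_norm_sq _
    rcases hside with h | h
    · refine Or.inl (Filter.Eventually.of_forall fun s => ?_)
      have := h _ (hmem _ (hηmem s))
      simp only [← hη, hsq, hw]
      nlinarith
    · refine Or.inr (Filter.Eventually.of_forall fun s => ?_)
      have := h _ (hmem _ (hηmem s))
      simp only [← hη, hsq, hw]
      nlinarith [norm_nonneg (η s)]
  obtain ⟨p, q, hpq, hp, hq, hpG, hqG, huniq⟩ := exists_contact_points hf hg hετ
  refine ⟨scaling a b p, scaling a b q, (scaling_injective ha hb).ne hpq,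
    htan p hp ((hiff p hp).2 hpG), htan q hq ((hiff q hq).2 hqG), ?_⟩
  rintro _ ⟨⟨t, rfl⟩, ht⟩
  refine hS _ (hmem _ (hηmem t)) fun h1 => ht ?_
  rcases huniq _ h1 ((hiff _ h1).1 (hηmem t)) with h | h
  · exact Or.inl (congrArg (scaling a b) h)
  · exact Or.inr (congrArg (scaling a b) h)

/-! ### The envelope polynomial -/

theorem eval_envelopePoly (a b : ℝ) (f g : ℂ) (x y : ℝ) :
    MvPolynomial.eval ![x, y] (envelopePoly a b f g) =
      envelopeExpr a b f.re f.im g.re g.im x y := by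
  simp [envelopePoly, envelopeExpr]

theorem envelopeExpr_eq {a b d ε : ℝ} (hd : 0 < d) (hε : ε ^ 2 = 1)
    (hεd : ε * d = a ^ 2 - b ^ 2) (f g w : ℂ) :
    envelopeExpr a b f.re f.im g.re g.im (a * w.re) (b * w.im) = a ^ 2 * b ^ 2 * d ^ 2 *
      (quadA ((a ^ 2 + b ^ 2) / d) ε f g w ^ 2 - ‖linB f g w‖ ^ 2) := by
  have h1 : d * quadA ((a ^ 2 + b ^ 2) / d) ε f g w = (a ^ 2 + b ^ 2) * (Complex.normSq w - 1) +
      (a ^ 2 - b ^ 2) * ((w - f) * (w - g)).re := by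
    rw [quadA, ← hεd]
    field_simp
  have h2 : d ^ 2 = (a ^ 2 - b ^ 2) ^ 2 := by
    rw [← hεd]
    linear_combination (-d ^ 2) * hε
  have h3 : a ^ 2 * b ^ 2 * d ^ 2 *
      (quadA ((a ^ 2 + b ^ 2) / d) ε f g w ^ 2 - ‖linB f g w‖ ^ 2) =
      a ^ 2 * b ^ 2 * (((a ^ 2 + b ^ 2) * (Complex.normSq w - 1) +
        (a ^ 2 - b ^ 2) * ((w - f) * (w - g)).re) ^ 2 -
        (a ^ 2 - b ^ 2) ^ 2 * Complex.normSq (linB f g w)) := by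
    rw [← h1, ← h2, Complex.normSq_eq_norm_sq]
    ring
  rw [h3]
  simp only [envelopeExpr, linB, Complex.normSq_apply, Complex.add_re, Complex.mul_re,
    Complex.conj_re, Complex.conj_im, Complex.add_im, Complex.mul_im, Complex.sub_re,
    Complex.sub_im]
  ring

/-! ### Degree of the envelope polynomial -/

section TotalDegree

open MvPolynomial

variable {p q : MvPolynomial (Fin 2) ℝ} {m n : ℕ}

theorem totalDegree_add_le (hp : p.totalDegree ≤ m) (hq : q.totalDegree ≤ n) :
    (p + q).totalDegree ≤ max m n :=
  (totalDegree_add p q).trans (max_le_max hp hq)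

theorem totalDegree_sub_le (hp : p.totalDegree ≤ m) (hq : q.totalDegree ≤ n) :
    (p - q).totalDegree ≤ max m n :=
  (totalDegree_sub p q).trans (max_le_max hp hq)

theorem totalDegree_mul_le (hp : p.totalDegree ≤ m) (hq : q.totalDegree ≤ n) :
    (p * q).totalDegree ≤ m + n :=
  (totalDegree_mul p q).trans (add_le_add hp hq)

theorem totalDegree_pow_le (hp : p.totalDegree ≤ m) (n : ℕ) : (p ^ n).totalDegree ≤ n * m :=
  (totalDegree_pow p n).trans (Nat.mul_le_mul_left n hp)

theorem totalDegree_neg_le (hp : p.totalDegree ≤ m) : (-p).totalDegree ≤ m :=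
  (totalDegree_neg p).trans_le hp

theorem totalDegree_ofNat_le (k : ℕ) [k.AtLeastTwo] :
    (OfNat.ofNat k : MvPolynomial (Fin 2) ℝ).totalDegree ≤ 0 := by
  rw [← map_ofNat (C : ℝ →+* MvPolynomial (Fin 2) ℝ) k, totalDegree_C]

end TotalDegree

theorem totalDegree_envelopePoly_le (a b : ℝ) (f g : ℂ) :
    (envelopePoly a b f g).totalDegree ≤ 4 := by
  unfold envelopePoly envelopeExpr
  -- The intermediate bound is left as a metavariable, assembled from `max`, sums and products along
  -- the expression tree and finally evaluated by `decide`.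
  apply le_trans
  · repeat' first
      | with_reducible exact (MvPolynomial.totalDegree_C _).le
      | with_reducible exact (MvPolynomial.totalDegree_X _).le
      | with_reducible exact MvPolynomial.totalDegree_one.le
      | with_reducible exact totalDegree_ofNat_le _
      | with_reducible apply totalDegree_add_le
      | with_reducible apply totalDegree_sub_le
      | with_reducible apply totalDegree_mul_le
      | with_reducible apply totalDegree_pow_le
      | with_reducible apply totalDegree_neg_le
  · decide

theorem fourth_difference_eq_zero {p : Polynomial ℝ} (hp : p.natDegree < 4) :
    p.eval 2 - 4 * p.eval 1 + 6 * p.eval 0 - 4 * p.eval (-1) + p.eval (-2) = 0 := by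
  simp only [Polynomial.eval_eq_sum_range' hp, Finset.sum_range_succ, Finset.sum_range_zero]
  ring

theorem totalDegree_envelopePoly {a b : ℝ} (ha : 0 < a) (hb : 0 < b) (f g : ℂ) :
    (envelopePoly a b f g).totalDegree = 4 := by
  refine (totalDegree_envelopePoly_le a b f g).antisymm ?_
  by_contra! hcon
  have h1 := MvPolynomial.aeval_natDegree_le (m := 3) (n := 1) (envelopePoly a b f g)
    (by omega) ![Polynomial.X, 0] (by
      intro i
      fin_cases i
      · exact Polynomial.natDegree_X_le
      · simp)
  have h2 : ∀ t : ℝ, (MvPolynomial.aeval ![Polynomial.X, 0] (envelopePoly a b f g) :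
      Polynomial ℝ).eval t = envelopeExpr a b f.re f.im g.re g.im t 0 := by
    intro t
    simp [envelopePoly, envelopeExpr]
  have h3 := fourth_difference_eq_zero (lt_of_le_of_lt h1 (by norm_num))
  simp only [h2] at h3
  -- On y = 0 the coefficient of x⁴ is 4a²b², and the fourth difference multiplies it by 4! = 24.
  have h4 : 96 * (a ^ 2 * b ^ 2) = 0 := by
    rw [← h3]
    unfold envelopeExpr
    ring
  have : 0 < a ^ 2 * b ^ 2 := by positivity
  linarith

/-- `scaling` as a homeomorphism. -/
def scalingHomeomorph {a b : ℝ} (ha : 0 < a) (hb : 0 < b) : ℂ ≃ₜ ℂ where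
  toFun := scaling a b
  invFun := scaling a⁻¹ b⁻¹
  left_inv z := by
    apply Complex.ext
    · simp only [scaling_re]; field_simp
    · simp only [scaling_im]; field_simp
  right_inv z := by
    apply Complex.ext
    · simp only [scaling_re]; field_simp
    · simp only [scaling_im]; field_simp
  continuous_toFun := (scalingL a b).continuous
  continuous_invFun := (scalingL a⁻¹ b⁻¹).continuous

theorem frontier_sweptRegion {a b d ε : ℝ} (ha : 0 < a) (hb : 0 < b) (hd : 0 < d)
    (hε : ε = 1 ∨ ε = -1) (hεd : ε * d = a ^ 2 - b ^ 2) (hK : 1 < (a ^ 2 + b ^ 2) / d)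
    {f g : ℂ} {k : ℝ} (hk : dist f g < 2 * k) (hf : ‖f‖ < 1) (hg : ‖g‖ < 1)
    (hporism : ∃ T : Affine.Triangle ℝ ℂ,
      IsPonceletTriangle (outerEllipse a b) (caustic a b f g k) T) :
    frontier (sweptRegion (outerEllipse a b) (caustic a b f g k)) =
      scaling a b '' {w | |quadA ((a ^ 2 + b ^ 2) / d) ε f g w| = ‖linB f g w‖} := by
  have hε2 : ε ^ 2 = 1 := by rcases hε with rfl | rfl <;> norm_num
  have hεabs : |ε| = 1 := by rcases hε with rfl | rfl <;> simp
  have hS : sweptRegion (outerEllipse a b) (caustic a b f g k) = scaling a b ''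
      {w | |quadA ((a ^ 2 + b ^ 2) / d) ε f g w| ≤ ‖linB f g w‖} := by
    ext z
    obtain ⟨w, rfl⟩ := scaling_surjective ha hb z
    rw [scaling_mem_sweptRegion_iff ha hb hd hε2 hεd hk hf hg hporism]
    rw [(scaling_injective ha hb).mem_set_image]
    rfl
  rw [hS, show scaling a b = scalingHomeomorph ha hb from rfl, ← (scalingHomeomorph ha hb).image_frontier,
    frontier_abs_quadA_le (hεabs ▸ hK) hf hg]

end PonceletEnvelope

end

theorem mainTheorem6 (a b : ℝ) (ha : 0 < a) (hb : 0 < b) (hab : a ≠ b)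
    (f g : ℂ) (k : ℝ) (hk : dist f g < 2 * k)
    (hnested : PonceletEnvelope.caustic a b f g k ⊆ PonceletEnvelope.outerInterior a b)
    (hporism : ∃ T : Affine.Triangle ℝ ℂ, PonceletEnvelope.IsPonceletTriangle
      (PonceletEnvelope.outerEllipse a b) (PonceletEnvelope.caustic a b f g k) T) :
    (PonceletEnvelope.envelopePoly a b f g).totalDegree = 4 ∧
    frontier (PonceletEnvelope.sweptRegion
        (PonceletEnvelope.outerEllipse a b) (PonceletEnvelope.caustic a b f g k)) =
      {z : ℂ | MvPolynomial.eval ![z.re, z.im] (PonceletEnvelope.envelopePoly a b f g) = 0} ∧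
    ∃ γ₁ γ₂ : ℝ → ℂ,
      PonceletEnvelope.IsSmoothClosedCurve γ₁ ∧
      PonceletEnvelope.IsSmoothClosedCurve γ₂ ∧
      Disjoint (Set.range γ₁) (Set.range γ₂) ∧
      frontier (PonceletEnvelope.sweptRegion
          (PonceletEnvelope.outerEllipse a b) (PonceletEnvelope.caustic a b f g k)) =
        Set.range γ₁ ∪ Set.range γ₂ ∧
      PonceletEnvelope.IsTangentAtTwoPointsFrom (PonceletEnvelope.outerExterior a b) γ₁
        (PonceletEnvelope.outerEllipse a b) ∧
      PonceletEnvelope.IsTangentAtTwoPointsFrom (PonceletEnvelope.outerInterior a b) γ₂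
        (PonceletEnvelope.outerEllipse a b) := by
  open PonceletEnvelope in
  have hdisc : ∀ w ∈ focalEllipse f g k, ‖w‖ < 1 := fun w hw =>
    (scaling_mem_outerInterior ha hb).1 (hnested ⟨w, hw, rfl⟩)
  have hf := norm_focus_lt_one hk hdisc
  have hg := norm_focus_lt_one (by rwa [dist_comm]) (focalEllipse_comm f g k ▸ hdisc)
  have ha2 : 0 < a ^ 2 := by positivity
  have hb2 : 0 < b ^ 2 := by positivity
  -- d = |a² - b²| and ε is the sign of a² - b²; here a ≠ b is needed for d > 0.
  obtain ⟨d, ε, hd, hε, hεd, hK⟩ : ∃ d ε : ℝ, 0 < d ∧ (ε = 1 ∨ ε = -1) ∧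
      ε * d = a ^ 2 - b ^ 2 ∧ 1 < (a ^ 2 + b ^ 2) / d := by
    rcases lt_or_gt_of_ne hab with h | h
    · have : 0 < b ^ 2 - a ^ 2 := by nlinarith
      exact ⟨b ^ 2 - a ^ 2, -1, this, Or.inr rfl, by ring, by rw [one_lt_div this]; linarith⟩
    · have : 0 < a ^ 2 - b ^ 2 := by nlinarith
      exact ⟨a ^ 2 - b ^ 2, 1, this, Or.inl rfl, by ring, by rw [one_lt_div this]; linarith⟩
  have hε2 : ε ^ 2 = 1 := by rcases hε with rfl | rfl <;> norm_num
  have hεabs : |ε| = 1 := by rcases hε with rfl | rfl <;> simp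
  have hKε := hεabs.trans_lt hK
  have hfr := frontier_sweptRegion ha hb hd hε hεd hK hk hf hg hporism
  set K := (a ^ 2 + b ^ 2) / d with hKdef
  refine ⟨totalDegree_envelopePoly ha hb f g, ?_, envelopeCurve a b K ε 1 f g,
    envelopeCurve a b K ε (-1) f g, isSmoothClosedCurve_envelopeCurve ha hb hKε hf hg _,
    isSmoothClosedCurve_envelopeCurve ha hb hKε hf hg _, ?_, ?_, ?_, ?_⟩
  · rw [hfr]
    ext z
    obtain ⟨w, rfl⟩ := scaling_surjective ha hb z
    rw [(scaling_injective ha hb).mem_set_image]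
    change |quadA K ε f g w| = _ ↔ MvPolynomial.eval _ _ = 0
    rw [eval_envelopePoly, scaling_re, scaling_im, envelopeExpr_eq hd hε2 hεd, mul_eq_zero,
      or_iff_right (by positivity), sub_eq_zero, sq_eq_sq_iff_abs_eq_abs, abs_norm]
  · rw [range_envelopeCurve hKε hf hg, range_envelopeCurve hKε hf hg,
      Set.disjoint_image_iff (scaling_injective ha hb), Set.disjoint_left]
    intro w h1 h2
    change quadA K ε f g w = _ at h1 h2
    -- A common point would satisfy A = |B| = -|B|, so B = 0 and A = 0, but A is negative at the
    -- zero of B.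
    have hn : ‖linB f g w‖ = 0 := by linarith
    have hw := invLin_linB_add hf hg w
    rw [norm_eq_zero.1 hn, map_zero, add_zero] at hw
    have := quadA_linBZero_neg hKε hf hg
    rw [hw, h1, hn] at this
    linarith
  · rw [hfr, range_envelopeCurve hKε hf hg, range_envelopeCurve hKε hf hg, ← Set.image_union]
    congr 1
    ext w
    change |quadA K ε f g w| = _ ↔ quadA K ε f g w = _ ∨ quadA K ε f g w = _
    rw [abs_eq (norm_nonneg _), one_mul, neg_one_mul]
  · refine isTangentAtTwoPointsFrom_envelopeCurve ha hb hε (Or.inl rfl) hK hf hg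
      (side := Set.Ici 1) (Or.inl fun r hr => hr)
      (fun w hw => one_le_norm_of_quadA_eq hεabs hKε hf hg hw) fun w hw hne => ?_
    exact (scaling_mem_outerExterior ha hb).2 (lt_of_le_of_ne hw hne.symm)
  · refine isTangentAtTwoPointsFrom_envelopeCurve ha hb hε (Or.inr rfl) hK hf hg
      (side := Set.Iic 1) (Or.inr fun r hr => hr)
      (fun w hw => norm_le_one_of_quadA_eq hεabs hKε hf hg hw) fun w hw hne => ?_
    exact (scaling_mem_outerInterior ha hb).2 (lt_of_le_of_ne hw hne)
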